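/- **Ordinary Ingham--Siegel integral for $\beta\in\{1,2,4\}$.** Let $\gamma_2=1$ for $\beta=1,2$, $\gamma_2=2$ for $\beta=4$, and $\gamma_1=2\gamma_2/\beta$. Let $\mathrm{Herm}(\beta,m)$ be the space of real symmetric ($\beta=1$), complex hermitian ($\beta=2$) or quaternionic self-adjoint ($\beta=4$) $m\times m$ matrices, quaternions being written as complex $2\times2$ matrices, so that elements are complex $\gamma_2m\times\gamma_2m$ matrices with the usual trace and determinant. Let $d[S]$ be the product of the differentials of all independent real and imaginary parts of the entries of $S$ (one real parameter for each diagonal entry and $\beta$ for each entry above the diagonal). Let $\varepsilon>0$, let $n\ge m-1+2/\beta$ be real, and put $S^+=S+i\varepsilon 1$. For real $p$ let $\det^{p}S^+=\prod_j(s_j+i\varepsilon)^p$ with principal powers, where $s_j$ runs through the $\gamma_2 m$ eigenvalues of $S$. Let $\Theta(R)=1$ if $R$ is positive definite and $\Theta(R)=0$ otherwise, and $$F(R,S)=e^{-i\,\mathrm{tr}(RS^+)}\,{\det}^{-n/\gamma_1}S^+,\qquad V(R)=i^{-\beta mn/2}\,G^{(\beta)}_{n-m,m}\,{\det}^{\lambda}R\;\Theta(R),$$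 $$\lambda=\frac{n-m}{\gamma_1}-\frac{\gamma_1-\gamma_2}{2},\qquad G^{(\beta)}_{n-m,m}=\Big(\frac{\gamma_2}{\pi}\Big)^{\beta m(n-m+1)/2-m}\prod_{j=n-m+1}^{n}\frac{2\pi^{\beta j/2}}{\Gamma(\beta j/2)},$$ with $j$ running in unit steps and $i^{x}=e^{i\pi x/2}$. Then $$\int_{\mathrm{Herm}(\beta,m)}F(R,S)\,d[S]=V(R),\qquad R\in \mathrm{Herm}(\beta,m),$$ in the following sense. 1. If $n>2(m-1)+2/\beta$, then for every $R\in\mathrm{Herm}(\beta,m)$ the integral converges absolutely and equals $V(R)$. 2. For every $n\ge m-1+2/\beta$ the identity holds pointwise with the (in general only conditionally convergent) integral understood as Gauss sum: for every $\delta>0$ the function $S\mapsto e^{-\delta\,\mathrm{tr}S^2}F(R,S)$ is integrable, and $$\lim_{\delta\downarrow0}\int e^{-\delta\,\mathrm{tr}S^2}F(R,S)\,d[S]=V(R)$$ for every $R\in\mathrm{Herm}(\beta,m)$; if $n=m-1+2/\beta$ (that is, $\lambda=0$) the $R$ that are positive semidefinite but not positive definite, where $V$ is discontinuous, are excepted.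 3. For every $n\ge m-1+2/\beta$ the identity holds weakly: for every $\varphi:\mathrm{Herm}(\beta,m)\to\mathbb C$ such that $e^{\varepsilon\,\mathrm{tr}R}\varphi(R)$ is a Schwartz function of $R$ (in particular every smooth compactly supported $\varphi$), $$\int\Big(\int\varphi(R)F(R,S)\,d[R]\Big)d[S]=\int\varphi(R)V(R)\,d[R],$$ where for every $S$ the inner integral on the left, the outer integral on the left, and the integral on the right converge absolutely. -/

import Mathlib

open scoped ComplexOrder Kronecker SchwartzMap

/-- `γ₂ = 1` for `β = 1, 2` and `γ₂ = 2` for `β = 4`: quaternions are complex `2 × 2` matrices. -/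
def gammaTwo (β : ℕ) : ℕ := if β = 4 then 2 else 1

/-- `γ₁ = 2 γ₂ / β`. -/
noncomputable def gammaOne (β : ℕ) : ℝ := 2 * (gammaTwo β : ℝ) / (β : ℝ)

/-- Complex `γ₂ m × γ₂ m` matrices, seen as `m × m` matrices of `γ₂ × γ₂` blocks. -/
abbrev BlockMatrix (β m : ℕ) : Type :=
  Matrix (Fin m × Fin (gammaTwo β)) (Fin m × Fin (gammaTwo β)) ℂ

/-- The antisymmetric block `Y`; it is `[[0, 1], [-1, 0]]` for `β = 4`. -/
def symplecticBlock (β : ℕ) : Matrix (Fin (gammaTwo β)) (Fin (gammaTwo β)) ℂ :=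
  fun a b => if a < b then 1 else if b < a then -1 else 0

/-- `Herm(β, m)`: the real symmetric (`β = 1`), complex hermitian (`β = 2`) and quaternionic
self-adjoint (`β = 4`) `m × m` matrices, the last ones in the complex `2m × 2m` representation. -/
def Herm (β m : ℕ) : Set (BlockMatrix β m) :=
  {A | A.IsHermitian ∧ (β = 1 → A.map star = A) ∧
    (β = 4 → A.map star =
      ((1 : Matrix (Fin m) (Fin m) ℂ) ⊗ₖ symplecticBlock β) * A *
        ((1 : Matrix (Fin m) (Fin m) ℂ) ⊗ₖ symplecticBlock β).transpose)}

/-- The independent real parameters of a matrix in `Herm(β, m)`: one for each diagonal entry and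
`β` (real and imaginary parts) for each entry above the diagonal. -/
abbrev HermIdx (β m : ℕ) : Type :=
  Fin m ⊕ ({p : Fin m × Fin m // p.1 < p.2} × Fin β)

/-- The space of independent real parameters of `Herm(β, m)`. Its Lebesgue measure `volume` is the
measure `d[S]`, the product of the differentials of all independent real and imaginary parts. -/
abbrev HermCoord (β m : ℕ) : Type := HermIdx β m → ℝ

/-- The block of the number `c₀ + c₁ i + c₂ j + c₃ k`, where `c_l = 0` for `l ≥ β`:
`[c₀]` for `β = 1`, `[c₀ + i c₁]` for `β = 2`, and
`[[c₀ + i c₁, c₂ + i c₃], [-c₂ + i c₃, c₀ - i c₁]]` for `β = 4`. -/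
noncomputable def numberBlock (β : ℕ) (c : Fin β → ℝ) :
    Matrix (Fin (gammaTwo β)) (Fin (gammaTwo β)) ℂ :=
  let d : ℕ → ℂ := fun l => if h : l < β then ((c ⟨l, h⟩ : ℝ) : ℂ) else 0
  fun a b =>
    if a < b then d 2 + Complex.I * d 3
    else if b < a then -d 2 + Complex.I * d 3
    else if (a : ℕ) = 0 then d 0 + Complex.I * d 1
    else d 0 - Complex.I * d 1

/-- The matrix in `Herm(β, m)` with the given independent real parameters. -/
noncomputable def hermMatrix (β m : ℕ) (x : HermCoord β m) : BlockMatrix β m :=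
  fun p q =>
    if h : p.1 < q.1 then numberBlock β (fun l => x (Sum.inr (⟨(p.1, q.1), h⟩, l))) p.2 q.2
    else if h : q.1 < p.1 then
      star (numberBlock β (fun l => x (Sum.inr (⟨(q.1, p.1), h⟩, l))) q.2 p.2)
    else if p.2 = q.2 then ((x (Sum.inl p.1) : ℝ) : ℂ) else 0

/-- `S⁺ = S + i ε 1`. -/
noncomputable def shiftPlus {β m : ℕ} (ε : ℝ) (S : BlockMatrix β m) : BlockMatrix β m :=
  S + (Complex.I * (ε : ℂ)) • (1 : BlockMatrix β m)

/-- The power `det^p A`: the product of the principal `p`-th powers of the eigenvalues of `A`,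
counted with algebraic multiplicity. On matrices without eigenvalues in `(-∞, 0]`, such as
`S + i ε 1` with `S` hermitian and `ε > 0`, it is the continuous branch of `(det A)^p` that is
positive on positive definite matrices (the principal power of the number `det A` is not). -/
noncomputable def detPow {ι : Type*} [Fintype ι] [DecidableEq ι] (A : Matrix ι ι ℂ) (p : ℂ) : ℂ :=
  (A.charpoly.roots.map (fun z => z ^ p)).prod

open Classical in
/-- `Θ(R) = 1` if `R` is positive definite, and `0` otherwise. -/
noncomputable def matrixHeaviside {ι : Type*} [Fintype ι] (R : Matrix ι ι ℂ) : ℂ :=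
  if R.PosDef then 1 else 0

/-- `λ = (n - m) / γ₁ - (γ₁ - γ₂) / 2`. -/
noncomputable def inghamExponent (β m : ℕ) (n : ℝ) : ℝ :=
  (n - m) / gammaOne β - (gammaOne β - (gammaTwo β : ℝ)) / 2

/-- `G = (γ₂ / π)^(β m (n - m + 1) / 2 - m) ∏_{j = n - m + 1}^{n} 2 π^(β j / 2) / Γ(β j / 2)`,
where `j` runs through `n - m + 1, n - m + 2, …, n`. -/
noncomputable def inghamConstant (β m : ℕ) (n : ℝ) : ℝ :=
  ((gammaTwo β : ℝ) / Real.pi) ^ ((β : ℝ) * m * (n - m + 1) / 2 - m) *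
    ∏ k ∈ Finset.range m,
      2 * Real.pi ^ ((β : ℝ) * (n - m + 1 + k) / 2) / Real.Gamma ((β : ℝ) * (n - m + 1 + k) / 2)

/-- The integrand `exp(-i tr R S⁺) det^(-n / γ₁) S⁺`. -/
noncomputable def inghamIntegrand {β m : ℕ} (n ε : ℝ) (R S : BlockMatrix β m) : ℂ :=
  Complex.exp (-Complex.I * (R * shiftPlus ε S).trace) *
    detPow (shiftPlus ε S) (((-(n / gammaOne β) : ℝ)) : ℂ)

/-- The value `i^(-β m n / 2) G det^λ R Θ(R)`. -/
noncomputable def inghamValue {β m : ℕ} (n : ℝ) (R : BlockMatrix β m) : ℂ :=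
  Complex.I ^ (((-((β : ℝ) * m * n / 2) : ℝ)) : ℂ) * ((inghamConstant β m n : ℝ) : ℂ) *
    R.det ^ ((inghamExponent β m n : ℝ) : ℂ) * matrixHeaviside R

/-- Test functions on `Herm(β, m)`: `R ↦ exp(ε tr R) φ(R)` is a Schwartz function. -/
def IsInghamTest (β m : ℕ) (ε : ℝ) (φ : HermCoord β m → ℂ) : Prop :=
  ∃ ψ : 𝓢(HermCoord β m, ℂ), ∀ x, ψ x = Complex.exp ((ε : ℂ) * (hermMatrix β m x).trace) * φ x


/-- The parametrization of `Herm(β, m)` is injective. -/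
theorem hermMatrix_injective (β m : ℕ) (hβ : β = 1 ∨ β = 2 ∨ β = 4) :
    Function.Injective (hermMatrix β m) := by
  intro x y hxy
  have z0 : (0 : ℕ) < gammaTwo β := by unfold gammaTwo; split_ifs <;> norm_num
  funext i
  rcases i with j | ⟨⟨⟨j, k⟩, hjk⟩, l⟩
  · have h := congrFun (congrFun hxy (j, ⟨0, z0⟩)) (j, ⟨0, z0⟩)
    simpa [hermMatrix] using h
  · have hjk' : j < k := hjk
    have h0 := congrFun (congrFun hxy (j, ⟨0, z0⟩)) (k, ⟨0, z0⟩)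
    rcases hβ with rfl | rfl | rfl
    · fin_cases l
      simpa [hermMatrix, hjk', numberBlock] using h0
    · have hr := congrArg Complex.re h0
      have hi := congrArg Complex.im h0
      fin_cases l
      · simpa [hermMatrix, hjk', numberBlock] using hr
      · simpa [hermMatrix, hjk', numberBlock] using hi
    · have h1 := congrFun (congrFun hxy (j, (0 : Fin 2))) (k, (1 : Fin 2))
      have hlt : (show Fin (gammaTwo 4) from (0 : Fin 2)) < (show Fin (gammaTwo 4) from (1 : Fin 2)) := by decide
      have hr := congrArg Complex.re h0
      have hi := congrArg Complex.im h0
      have hr1 := congrArg Complex.re h1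
      have hi1 := congrArg Complex.im h1
      simp [hermMatrix, hjk', numberBlock] at hr hi
      simp only [hermMatrix, hjk', numberBlock, dite_true] at hr1 hi1
      erw [if_pos hlt, if_pos hlt] at hr1 hi1
      simp at hr1 hi1
      fin_cases l
      · exact hr
      · exact hi
      · exact hr1
      · exact hi1

theorem symplectic_conj_apply (β m : ℕ) (A : BlockMatrix β m)
    (p q : Fin m × Fin (gammaTwo β)) :
    (((1 : Matrix (Fin m) (Fin m) ℂ) ⊗ₖ symplecticBlock β) * A *
        ((1 : Matrix (Fin m) (Fin m) ℂ) ⊗ₖ symplecticBlock β).transpose) p q =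
      ∑ b, (∑ a, symplecticBlock β p.2 a * A (p.1, a) (q.1, b)) * symplecticBlock β q.2 b := by
  simp [Matrix.mul_apply, Fintype.sum_prod_type, Matrix.one_apply, ite_mul, mul_ite]

/-- The quaternionic reality condition, entry by entry. -/
theorem symplectic_iff (m : ℕ) (A : Matrix (Fin m × Fin 2) (Fin m × Fin 2) ℂ) :
    (A.map star = ((1 : Matrix (Fin m) (Fin m) ℂ) ⊗ₖ symplecticBlock 4) * (show BlockMatrix 4 m from A) *
        ((1 : Matrix (Fin m) (Fin m) ℂ) ⊗ₖ symplecticBlock 4).transpose) ↔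
      ∀ j k, A (j, 1) (k, 1) = star (A (j, 0) (k, 0)) ∧
        A (j, 1) (k, 0) = -star (A (j, 0) (k, 1)) := by
  have key : ∀ (p q : Fin m × Fin 2),
      (((1 : Matrix (Fin m) (Fin m) ℂ) ⊗ₖ symplecticBlock 4) * (show BlockMatrix 4 m from A) *
        ((1 : Matrix (Fin m) (Fin m) ℂ) ⊗ₖ symplecticBlock 4).transpose) p q =
      ∑ b : Fin 2, (∑ a : Fin 2, (if p.2 < a then 1 else if a < p.2 then -1 else 0) *
        A (p.1, a) (q.1, b)) * (if q.2 < b then 1 else if b < q.2 then -1 else 0) :=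
    fun p q => symplectic_conj_apply 4 m A p q
  constructor
  · intro h j k
    have h1 := congrFun (congrFun h (j, (0 : Fin 2))) (k, (0 : Fin 2))
    have h2 := congrFun (congrFun h (j, (0 : Fin 2))) (k, (1 : Fin 2))
    erw [key] at h1 h2
    simp [Fin.sum_univ_two] at h1 h2
    exact ⟨by simp [h1], by simp [h2]⟩
  · intro h
    ext ⟨j, a⟩ ⟨k, b⟩
    refine Eq.trans ?_ (key _ _).symm
    obtain ⟨h1, h2⟩ := h j k
    change Fin 2 at a b
    fin_cases a <;> fin_cases b <;> simp [Fin.sum_univ_two, h1, h2]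

theorem hermMatrix_isHermitian (β m : ℕ) (x : HermCoord β m) :
    (hermMatrix β m x).IsHermitian := by
  ext ⟨j, a⟩ ⟨k, b⟩
  rcases lt_trichotomy j k with h | h | h
  · simp [hermMatrix, h, h.not_gt]
  · subst h
    by_cases hab : a = b
    · simp [hermMatrix, hab]
    · simp [hermMatrix, hab, Ne.symm hab]
  · simp [hermMatrix, h, h.not_gt]

theorem numberBlock_four (c : Fin 4 → ℝ) (a b : Fin 2) :
    numberBlock 4 c a b = !![(c 0 : ℂ) + Complex.I * c 1, c 2 + Complex.I * c 3;
      -c 2 + Complex.I * c 3, c 0 - Complex.I * c 1] a b := by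
  fin_cases a <;> fin_cases b <;> rfl

theorem four_lt (m : ℕ) (x : HermCoord 4 m) {j k : Fin m} (h : j < k) (a b : Fin 2) :
    hermMatrix 4 m x (j, a) (k, b) =
      !![(x (Sum.inr (⟨(j, k), h⟩, 0)) : ℂ) + Complex.I * x (Sum.inr (⟨(j, k), h⟩, 1)),
        x (Sum.inr (⟨(j, k), h⟩, 2)) + Complex.I * x (Sum.inr (⟨(j, k), h⟩, 3));
        -x (Sum.inr (⟨(j, k), h⟩, 2)) + Complex.I * x (Sum.inr (⟨(j, k), h⟩, 3)),
        x (Sum.inr (⟨(j, k), h⟩, 0)) - Complex.I * x (Sum.inr (⟨(j, k), h⟩, 1))] a b := by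
  refine Eq.trans ?_ (numberBlock_four (fun l => x (Sum.inr (⟨(j, k), h⟩, l))) a b)
  exact dif_pos h

theorem hermMatrix_diag (β m : ℕ) (x : HermCoord β m) (j : Fin m) (a b : Fin (gammaTwo β)) :
    hermMatrix β m x (j, a) (j, b) = if a = b then ((x (Sum.inl j) : ℝ) : ℂ) else 0 :=
  (dif_neg (lt_irrefl j)).trans (dif_neg (lt_irrefl j))

theorem herm_ext {β m : ℕ} {A B : BlockMatrix β m} (hA : A.IsHermitian) (hB : B.IsHermitian)
    (h : ∀ j k a b, j ≤ k → A (j, a) (k, b) = B (j, a) (k, b)) : A = B := by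
  ext ⟨j, a⟩ ⟨k, b⟩
  rcases le_total j k with hjk | hjk
  · exact h j k a b hjk
  · rw [← hA.apply, ← hB.apply, h k j b a hjk]

theorem hermMatrix_mem (β m : ℕ) (x : HermCoord β m) : hermMatrix β m x ∈ Herm β m := by
  refine ⟨hermMatrix_isHermitian β m x, ?_, ?_⟩
  · rintro rfl
    ext ⟨j, a⟩ ⟨k, b⟩
    change Fin 1 at a b
    obtain rfl := Subsingleton.elim a b
    rcases lt_trichotomy j k with h | h | h
    · simp [hermMatrix, numberBlock, h]
      split_ifs <;> simp
    · simp [hermMatrix, h]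
      split_ifs <;> simp
    · simp [hermMatrix, numberBlock, h, h.not_gt]
      split_ifs <;> simp
  · rintro rfl
    obtain ⟨B, hB⟩ : ∃ B : Matrix (Fin m × Fin 2) (Fin m × Fin 2) ℂ, B = hermMatrix 4 m x :=
      ⟨_, rfl⟩
    have hlt := fun (j k : Fin m) (h : j < k) (a b : Fin 2) =>
      (congrFun (congrFun hB (j, a)) (k, b)).trans (four_lt m x h a b)
    have hdi : ∀ (j : Fin m) (a b : Fin 2),
        B (j, a) (j, b) = if a = b then ((x (Sum.inl j) : ℝ) : ℂ) else 0 := fun j a b =>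
      (congrFun (congrFun hB (j, a)) (j, b)).trans (hermMatrix_diag 4 m x j a b)
    have hco : ∀ (j k : Fin m) (a b : Fin 2), B (j, a) (k, b) = star (B (k, b) (j, a)) := by
      intro j k a b
      rw [hB]
      exact ((hermMatrix_isHermitian 4 m x).apply (j, a) (k, b)).symm
    rw [← hB]
    refine (symplectic_iff m B).2 fun j k => ?_
    rcases lt_trichotomy j k with h | rfl | h
    · simp [hlt j k h, sub_eq_add_neg, add_comm]
    · simp [hdi]
    · rw [hco j k, hco j k, hco j k, hco j k]
      simp [hlt k j h, sub_eq_add_neg, add_comm]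

/-- The parametrization is onto `Herm(β, m)`. -/
theorem range_hermMatrix (β m : ℕ) (hβ : β = 1 ∨ β = 2 ∨ β = 4) :
    Set.range (hermMatrix β m) = Herm β m := by
  apply Set.Subset.antisymm
  · rintro _ ⟨x, rfl⟩
    exact hermMatrix_mem β m x
  rintro A ⟨hA, h1, h4⟩
  rcases hβ with rfl | rfl | rfl
  · change Matrix (Fin m × Fin 1) (Fin m × Fin 1) ℂ at A
    refine ⟨Sum.elim (fun j => (A (j, 0) (j, 0)).re)
      (fun t => (A (t.1.1.1, 0) (t.1.1.2, 0)).re), ?_⟩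
    refine herm_ext (hermMatrix_isHermitian 1 m _) hA fun j k a b hjk => ?_
    change Fin 1 at a b
    obtain rfl := Subsingleton.elim 0 a
    obtain rfl := Subsingleton.elim 0 b
    have hr := congrFun (congrFun (h1 rfl) (j, (0 : Fin 1))) (k, (0 : Fin 1))
    have hr' : ((A (j, 0) (k, 0)).re : ℂ) = A (j, 0) (k, 0) := Complex.conj_eq_iff_re.1 hr
    refine Eq.trans ?_ hr'
    rcases hjk.lt_or_eq with h | rfl
    · refine (dif_pos h).trans ?_
      simp [numberBlock]
    · exact (hermMatrix_diag 1 m _ j _ _).trans (if_pos rfl)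
  · change Matrix (Fin m × Fin 1) (Fin m × Fin 1) ℂ at A
    refine ⟨Sum.elim (fun j => (A (j, 0) (j, 0)).re)
      (fun t => if t.2 = 0 then (A (t.1.1.1, 0) (t.1.1.2, 0)).re
        else (A (t.1.1.1, 0) (t.1.1.2, 0)).im), ?_⟩
    refine herm_ext (hermMatrix_isHermitian 2 m _) hA fun j k a b hjk => ?_
    change Fin 1 at a b
    obtain rfl := Subsingleton.elim 0 a
    obtain rfl := Subsingleton.elim 0 b
    rcases hjk.lt_or_eq with h | rfl
    · refine (dif_pos h).trans ?_
      simp [numberBlock]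
      rw [mul_comm]
      exact Complex.re_add_im _
    · refine ((hermMatrix_diag 2 m _ j _ _).trans (if_pos rfl)).trans ?_
      exact Complex.conj_eq_iff_re.1 (hA.apply (j, (0 : Fin 1)) (j, (0 : Fin 1)))
  · change Matrix (Fin m × Fin 2) (Fin m × Fin 2) ℂ at A
    have hq := (symplectic_iff m A).1 (h4 rfl)
    refine ⟨Sum.elim (fun j => (A (j, 0) (j, 0)).re)
      (fun t => ![(A (t.1.1.1, 0) (t.1.1.2, 0)).re, (A (t.1.1.1, 0) (t.1.1.2, 0)).im,
        (A (t.1.1.1, 0) (t.1.1.2, 1)).re, (A (t.1.1.1, 0) (t.1.1.2, 1)).im] t.2), ?_⟩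
    refine herm_ext (hermMatrix_isHermitian 4 m _) hA fun j k a b hjk => ?_
    change Fin 2 at a b
    obtain ⟨e1, e2⟩ := hq j k
    rcases hjk.lt_or_eq with h | rfl
    · refine (four_lt m _ h a b).trans ?_
      fin_cases a <;> fin_cases b
      · simp [Complex.ext_iff]
        exact ⟨rfl, rfl⟩
      · simp [Complex.ext_iff]
        exact ⟨rfl, rfl⟩
      · refine Eq.trans ?_ e2.symm
        simp [Complex.ext_iff]
      · refine Eq.trans ?_ e1.symm
        simp [Complex.ext_iff]
    · refine (hermMatrix_diag 4 m _ j a b).trans ?_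
      have d0 : ((A (j, 0) (j, 0)).re : ℂ) = A (j, 0) (j, 0) :=
        Complex.conj_eq_iff_re.1 (hA.apply (j, (0 : Fin 2)) (j, (0 : Fin 2)))
      have d1 : star (A (j, 1) (j, 0)) = A (j, 0) (j, 1) :=
        hA.apply (j, (0 : Fin 2)) (j, (1 : Fin 2))
      have d2 : A (j, 0) (j, 1) = 0 := by
        rw [e2] at d1
        simp at d1
        linear_combination (-1 / 2 : ℂ) * d1
      have d3 : star (A (j, 0) (j, 0)) = A (j, 0) (j, 0) :=
        hA.apply (j, (0 : Fin 2)) (j, (0 : Fin 2))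
      fin_cases a <;> fin_cases b
      · exact (if_pos rfl).trans d0
      · exact (if_neg (show ¬ (0 : Fin 2) = 1 by decide)).trans d2.symm
      · refine (if_neg (show ¬ (1 : Fin 2) = 0 by decide)).trans (Eq.trans ?_ e2.symm)
        simp [d2]
      · exact (if_pos rfl).trans ((d0.trans d3.symm).trans e1.symm)

/-!
The theorem is Fourier inversion for the density of a Wishart-type distribution. Put `a = β n / 2`
and let `W` be the function `Δ^(a - 1 - β (m - 1) / 2) e^(-ε tr)` on the cone of positive definite
matrices, extended by zero, where `Δ` is the Jordan determinant, so that `det = Δ^γ₂` for the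
complex `γ₂ m × γ₂ m` matrices (`coneWeight`).

* Its Laplace transform is `∫ Δ(X)^(a - 1 - β (m - 1) / 2) e^(-tr (X Z)) d[X] = Γ(a) Δ(Z)^(-a)` for
  positive definite `Z`, where `Γ(a)` is an explicit product of gamma functions (`coneGamma`,
  `lintegral_conePow_mul_exp`). This goes by induction on `m`. With `X = [[r, v], [v*, t]]` and the
  Schur complement `t - v* v / r` as a new variable, the integral separates into the same integral
  for `m - 1`, a Gaussian integral over the row `v` (`lintegral_exp_neg_rowForm`) and a gamma
  integral over `r`. Everything is nonnegative, so convergence comes with the value.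
* For fixed hermitian `S` the integral of `W e^(-z tr (X S))` is analytic in `z` as long as
  `ε + (Re z) S` is positive definite, and so is the product of the powers `(ε + z s_j)^(-a / γ₂)`
  over the eigenvalues `s_j` of `S`. By the identity theorem they agree at `z = -i`
  (`integral_coneWeight_mul_cexp`). Since `s_j + i ε = i (ε - i s_j)`, the power
  `det^(-n / γ₁) (S + i ε)` is thus `i^(-β m n / 2) / Γ(a)` times the Fourier transform of `W` at `-S`
  (`detPow_eq_fourier`).

In coordinates in which `tr (X Y) / (2 π)` is the standard inner product (`hermEuclid`), the
integrand `F(R, S)` is then, up to a constant and the factor `e^(ε tr R)`, the integrand of the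
inverse Fourier transform of `W` (`inghamIntegrand_eq`), and `V(R)` is what inversion predicts
(`inghamValue_eq`); the constant `G` is the square of the Jacobian over `Γ(a)`
(`sq_hermJacobian_div_coneGamma`). The three parts are three forms of Fourier inversion for the
integrable function `W`.

* Gauss summation recovers `W` wherever it is continuous, that is, everywhere if its exponent is
  positive, and off the boundary of the cone if the exponent is zero (`tendsto_gauss_sum`).
* If `n > 2 (m - 1) + 2 / β`, the Fourier transform of `W` is integrable: it is a multiple of the
  square of the transform for `a / 2`, which is square integrable by Plancherel
  (`integrable_fourier_euclidWeight`). By dominated convergence the integral is its own Gauss sum.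
* Against test functions the identity is Parseval's formula
  (`integral_test_mul_inghamIntegrand`).
-/

open Matrix MeasureTheory ProbabilityTheory
open scoped ENNReal FourierTransform RealInnerProductSpace

/-! ### Blocks of real, complex and quaternionic numbers -/

theorem gammaTwo_pos (β : ℕ) : 0 < gammaTwo β := by unfold gammaTwo; split_ifs <;> norm_num

/-- Makes `0 : Fin (gammaTwo β)` available. -/
instance (β : ℕ) : NeZero (gammaTwo β) := ⟨(gammaTwo_pos β).ne'⟩

theorem numberBlock_one (c : Fin 1 → ℝ) (a b : Fin 1) :
    numberBlock 1 c a b = (c 0 : ℂ) := by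
  obtain rfl := Subsingleton.elim a 0
  obtain rfl := Subsingleton.elim b 0
  simp [numberBlock]

theorem numberBlock_two (c : Fin 2 → ℝ) (a b : Fin 1) :
    numberBlock 2 c a b = (c 0 : ℂ) + Complex.I * c 1 := by
  fin_cases a; fin_cases b; rfl

theorem numberBlock_add (β : ℕ) (c d : Fin β → ℝ) :
    numberBlock β (c + d) = numberBlock β c + numberBlock β d := by
  have h : ∀ l : ℕ, (if h : l < β then (((c + d) ⟨l, h⟩ : ℝ) : ℂ) else 0) =
      (if h : l < β then ((c ⟨l, h⟩ : ℝ) : ℂ) else 0) +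
        (if h : l < β then ((d ⟨l, h⟩ : ℝ) : ℂ) else 0) := by
    intro l; split_ifs <;> simp
  ext a b
  rw [Matrix.add_apply]
  unfold numberBlock
  simp only [h]
  split_ifs <;> ring

theorem numberBlock_smul (β : ℕ) (t : ℝ) (c : Fin β → ℝ) :
    numberBlock β (t • c) = t • numberBlock β c := by
  have h : ∀ l : ℕ, (if h : l < β then (((t • c) ⟨l, h⟩ : ℝ) : ℂ) else 0) =
      t * (if h : l < β then ((c ⟨l, h⟩ : ℝ) : ℂ) else 0) := by
    intro l; split_ifs <;> simp
  ext a b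
  rw [Matrix.smul_apply, Complex.real_smul]
  unfold numberBlock
  simp only [h]
  split_ifs <;> ring

/-- `numberBlock` as a real linear map. -/
noncomputable def numberBlockL (β : ℕ) :
    (Fin β → ℝ) →ₗ[ℝ] Matrix (Fin (gammaTwo β)) (Fin (gammaTwo β)) ℂ where
  toFun := numberBlock β
  map_add' := numberBlock_add β
  map_smul' := numberBlock_smul β

/-- The real vector space of the blocks that represent numbers of `ℝ`, `ℂ` or `ℍ`. -/
noncomputable def blockSpace (β : ℕ) :
    Submodule ℝ (Matrix (Fin (gammaTwo β)) (Fin (gammaTwo β)) ℂ) :=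
  LinearMap.range (numberBlockL β)

theorem mem_blockSpace {β : ℕ} {B : Matrix (Fin (gammaTwo β)) (Fin (gammaTwo β)) ℂ} :
    B ∈ blockSpace β ↔ ∃ c, numberBlock β c = B := Iff.rfl

theorem numberBlock_mem (β : ℕ) (c : Fin β → ℝ) : numberBlock β c ∈ blockSpace β := ⟨c, rfl⟩

/-- The blocks are closed under products: they represent an algebra. -/
theorem mul_mem_blockSpace {β : ℕ} (hβ : β = 1 ∨ β = 2 ∨ β = 4)
    {B C : Matrix (Fin (gammaTwo β)) (Fin (gammaTwo β)) ℂ}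
    (hB : B ∈ blockSpace β) (hC : C ∈ blockSpace β) : B * C ∈ blockSpace β := by
  obtain ⟨c, rfl⟩ := mem_blockSpace.1 hB
  obtain ⟨d, rfl⟩ := mem_blockSpace.1 hC
  rcases hβ with rfl | rfl | rfl
  · refine mem_blockSpace.2 ⟨fun _ => c 0 * d 0, ?_⟩
    ext (a : Fin 1) (b : Fin 1)
    refine (numberBlock_one _ a b).trans ?_
    refine Eq.trans ?_ (Fin.sum_univ_one (fun j : Fin 1 => numberBlock 1 c a j * numberBlock 1 d j b)).symm
    simp [numberBlock_one]
  · refine ⟨![c 0 * d 0 - c 1 * d 1, c 0 * d 1 + c 1 * d 0], ?_⟩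
    ext (a : Fin 1) (b : Fin 1)
    refine (numberBlock_two _ a b).trans ?_
    refine Eq.trans ?_ (Fin.sum_univ_one (fun j : Fin 1 => numberBlock 2 c a j * numberBlock 2 d j b)).symm
    rw [numberBlock_two, numberBlock_two]
    simp
    linear_combination (- c 1 * d 1 : ℂ) * Complex.I_sq
  · refine ⟨![c 0 * d 0 - c 1 * d 1 - c 2 * d 2 - c 3 * d 3,
      c 0 * d 1 + c 1 * d 0 + c 2 * d 3 - c 3 * d 2,
      c 0 * d 2 - c 1 * d 3 + c 2 * d 0 + c 3 * d 1,
      c 0 * d 3 + c 1 * d 2 - c 2 * d 1 + c 3 * d 0], ?_⟩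
    ext (a : Fin 2) (b : Fin 2)
    refine (numberBlock_four _ a b).trans ?_
    refine Eq.trans ?_ (Fin.sum_univ_two (fun j : Fin 2 => numberBlock 4 c a j * numberBlock 4 d j b)).symm
    simp only [numberBlock_four]
    fin_cases a <;> fin_cases b <;> simp <;> ring_nf <;> simp [Complex.I_sq] <;> ring

theorem conjTranspose_mem_blockSpace {β : ℕ} (hβ : β = 1 ∨ β = 2 ∨ β = 4)
    {B : Matrix (Fin (gammaTwo β)) (Fin (gammaTwo β)) ℂ}
    (hB : B ∈ blockSpace β) : Bᴴ ∈ blockSpace β := by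
  obtain ⟨c, rfl⟩ := mem_blockSpace.1 hB
  rcases hβ with rfl | rfl | rfl
  · refine ⟨c, ?_⟩
    ext (a : Fin 1) (b : Fin 1)
    refine (numberBlock_one _ a b).trans ?_
    refine Eq.trans ?_ (congrArg star (numberBlock_one c b a)).symm
    simp
  · refine ⟨![c 0, - c 1], ?_⟩
    ext (a : Fin 1) (b : Fin 1)
    refine (numberBlock_two _ a b).trans ?_
    refine Eq.trans ?_ (congrArg star (numberBlock_two c b a)).symm
    simp
  · refine ⟨![c 0, - c 1, - c 2, - c 3], ?_⟩
    ext (a : Fin 2) (b : Fin 2)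
    refine (numberBlock_four _ a b).trans ?_
    refine Eq.trans ?_ (congrArg star (numberBlock_four c b a)).symm
    fin_cases a <;> fin_cases b <;> simp [sub_eq_add_neg]

/-- The polarized block norm is the Euclidean inner product of the coordinates. -/
theorem trace_numberBlock_mul_conjTranspose {β : ℕ} (hβ : β = 1 ∨ β = 2 ∨ β = 4)
    (c d : Fin β → ℝ) :
    (numberBlock β c * (numberBlock β d)ᴴ).trace + (numberBlock β d * (numberBlock β c)ᴴ).trace
      = (gammaTwo β : ℂ) * (2 * ∑ l, c l * d l : ℝ) := by
  rcases hβ with rfl | rfl | rfl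
  · have key : ∀ c d : Fin 1 → ℝ, (numberBlock 1 c * (numberBlock 1 d)ᴴ).trace
        = (c 0 : ℂ) * star (d 0 : ℂ) := fun c d => by
      refine (Fin.sum_univ_one (fun i : Fin 1 =>
        ∑ j : Fin 1, numberBlock 1 c i j * star (numberBlock 1 d i j))).trans ?_
      simp only [Fin.sum_univ_one, numberBlock_one]
    rw [key, key]
    simp [gammaTwo]; ring
  · have key : ∀ c d : Fin 2 → ℝ, (numberBlock 2 c * (numberBlock 2 d)ᴴ).trace
        = ((c 0 : ℂ) + Complex.I * c 1) * star ((d 0 : ℂ) + Complex.I * d 1) := fun c d => by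
      refine (Fin.sum_univ_one (fun i : Fin 1 =>
        ∑ j : Fin 1, numberBlock 2 c i j * star (numberBlock 2 d i j))).trans ?_
      simp only [Fin.sum_univ_one, numberBlock_two]
    rw [key, key]
    simp [gammaTwo]; ring_nf; simp [Complex.I_sq]
  · have key : ∀ c d : Fin 4 → ℝ, (numberBlock 4 c * (numberBlock 4 d)ᴴ).trace
        = ∑ i : Fin 2, ∑ j : Fin 2, numberBlock 4 c i j * star (numberBlock 4 d i j) :=
      fun c d => rfl
    rw [key, key]
    simp only [Fin.sum_univ_two, numberBlock_four]
    simp [gammaTwo, Fin.sum_univ_four]; ring_nf; simp [Complex.I_sq]; ring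

/-- The only self-adjoint numbers are the real ones. -/
theorem eq_smul_one_of_mem_blockSpace {β : ℕ} (hβ : β = 1 ∨ β = 2 ∨ β = 4)
    {B : Matrix (Fin (gammaTwo β)) (Fin (gammaTwo β)) ℂ}
    (hB : B ∈ blockSpace β) (hH : B.IsHermitian) : ∃ t : ℝ, B = (t : ℂ) • 1 := by
  obtain ⟨c, rfl⟩ := mem_blockSpace.1 hB
  rcases hβ with rfl | rfl | rfl
  · refine ⟨c 0, ?_⟩
    ext (a : Fin 1) (b : Fin 1)
    refine (numberBlock_one _ a b).trans ?_
    obtain rfl := Subsingleton.elim a b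
    change _ = (c 0 : ℂ) * (1 : Matrix (Fin 1) (Fin 1) ℂ) a a
    simp
  · have h := hH.apply (0 : Fin 1) (0 : Fin 1)
    have h2 := (congrArg star (numberBlock_two c 0 0)).symm.trans (h.trans (numberBlock_two c 0 0))
    refine ⟨c 0, ?_⟩
    ext (a : Fin 1) (b : Fin 1)
    refine (numberBlock_two _ a b).trans ?_
    obtain rfl := Subsingleton.elim a b
    change _ = (c 0 : ℂ) * (1 : Matrix (Fin 1) (Fin 1) ℂ) a a
    simp [Complex.ext_iff] at h2 ⊢
    linarith
  · have h (a b : Fin 2) := (congrArg star (numberBlock_four c a b)).symm.trans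
      ((hH.apply b a).trans (numberBlock_four c b a))
    have h00 := h 0 0
    have h01 := h 0 1
    refine ⟨c 0, ?_⟩
    ext (a : Fin 2) (b : Fin 2)
    refine (numberBlock_four _ a b).trans ?_
    change _ = (c 0 : ℂ) * (1 : Matrix (Fin 2) (Fin 2) ℂ) a b
    simp [Complex.ext_iff] at h00 h01
    have e1 : c 1 = 0 := by linarith
    have e2 : c 2 = 0 := by linarith
    have e3 : c 3 = 0 := by linarith
    fin_cases a <;> fin_cases b <;> simp [e1, e2, e3]

theorem trace_smul_one (β : ℕ) (t : ℂ) :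
    (t • (1 : Matrix (Fin (gammaTwo β)) (Fin (gammaTwo β)) ℂ)).trace = gammaTwo β * t := by
  simp [Matrix.trace_smul, mul_comm]

/-- The block norm is the Euclidean norm of the coordinates. -/
theorem numberBlock_mul_conjTranspose_self {β : ℕ} (hβ : β = 1 ∨ β = 2 ∨ β = 4) (c : Fin β → ℝ) :
    numberBlock β c * (numberBlock β c)ᴴ = ((∑ l, c l ^ 2 : ℝ) : ℂ) • 1 := by
  obtain ⟨t, ht⟩ := eq_smul_one_of_mem_blockSpace hβ
    (mul_mem_blockSpace hβ (numberBlock_mem β c)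
      (conjTranspose_mem_blockSpace hβ (numberBlock_mem β c)))
    (Matrix.isHermitian_mul_conjTranspose_self _)
  have h := trace_numberBlock_mul_conjTranspose hβ c c
  rw [ht, trace_smul_one] at h
  have hg : (gammaTwo β : ℂ) ≠ 0 := by exact_mod_cast (gammaTwo_pos β).ne'
  rw [ht]
  congr 1
  have : (gammaTwo β : ℂ) * (2 * t) = (gammaTwo β : ℂ) * (2 * ∑ l, c l * c l : ℝ) := by
    rw [← h]; ring
  have := mul_left_cancel₀ hg this
  push_cast at this ⊢
  simp only [pow_two]
  linear_combination this / 2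

/-! ### Self-adjoint matrices and rows of blocks -/

/-- The `(j, k)` block of a block matrix. -/
def blockAt {β m : ℕ} (A : BlockMatrix β m) (j k : Fin m) :
    Matrix (Fin (gammaTwo β)) (Fin (gammaTwo β)) ℂ := fun a b => A (j, a) (k, b)

/-- A row of `m` numbers, as a `γ₂ × γ₂ m` matrix. -/
noncomputable def rowBlock {β m : ℕ} (v : Fin m × Fin β → ℝ) :
    Matrix (Fin (gammaTwo β)) (Fin m × Fin (gammaTwo β)) ℂ :=
  fun a p => numberBlock β (fun l => v (p.1, l)) a p.2

theorem smul_one_mem_blockSpace {β : ℕ} (hβ : β = 1 ∨ β = 2 ∨ β = 4) (t : ℝ) :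
    ((t : ℂ) • 1 : Matrix (Fin (gammaTwo β)) (Fin (gammaTwo β)) ℂ) ∈ blockSpace β := by
  have h0 : 0 < β := by omega
  have h := mul_mem_blockSpace hβ (numberBlock_mem β (Pi.single ⟨0, h0⟩ 1))
      (conjTranspose_mem_blockSpace hβ (numberBlock_mem β (Pi.single ⟨0, h0⟩ 1)))
  rw [numberBlock_mul_conjTranspose_self hβ, Finset.sum_eq_single ⟨0, h0⟩] at h
  · convert (blockSpace β).smul_mem t h using 1
    ext a b
    simp [Matrix.smul_apply]
  · intro b _ hb
    simp [hb]
  · simp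

theorem blockAt_hermMatrix_mem {β m : ℕ} (hβ : β = 1 ∨ β = 2 ∨ β = 4) (x : HermCoord β m)
    (j k : Fin m) : blockAt (hermMatrix β m x) j k ∈ blockSpace β := by
  rcases lt_trichotomy j k with h | rfl | h
  · convert numberBlock_mem β (fun l => x (Sum.inr (⟨(j, k), h⟩, l))) using 1
    ext a b
    simp [blockAt, hermMatrix, h]
  · convert smul_one_mem_blockSpace hβ (x (Sum.inl j)) using 1
    ext a b
    simp [blockAt, hermMatrix_diag, Matrix.one_apply]
  · convert conjTranspose_mem_blockSpace hβ
      (numberBlock_mem β (fun l => x (Sum.inr (⟨(k, j), h⟩, l)))) using 1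
    ext a b
    simp [blockAt, hermMatrix, h, h.not_gt]

/-- A hermitian matrix whose blocks are numbers lies in `Herm(β, m)`. -/
theorem exists_hermMatrix_eq {β m : ℕ} (hβ : β = 1 ∨ β = 2 ∨ β = 4) {A : BlockMatrix β m}
    (hA : A.IsHermitian) (h : ∀ j k, blockAt A j k ∈ blockSpace β) :
    ∃ x, hermMatrix β m x = A := by
  have hd : ∀ j, ∃ t : ℝ, blockAt A j j = (t : ℂ) • 1 := fun j =>
    eq_smul_one_of_mem_blockSpace hβ (h j j) (by ext a b; exact hA.apply _ _)
  choose t ht using hd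
  choose c hc using fun j k => mem_blockSpace.1 (h j k)
  refine ⟨Sum.elim t (fun q => c q.1.1.1 q.1.1.2 q.2), ?_⟩
  refine herm_ext (hermMatrix_isHermitian β m _) hA fun j k a b hjk => ?_
  rcases hjk.lt_or_eq with h | rfl
  · refine (dif_pos h).trans ?_
    exact congrFun (congrFun (hc j k) a) b
  · rw [hermMatrix_diag]
    refine Eq.trans ?_ (congrFun (congrFun (ht j) a) b).symm
    simp [Matrix.one_apply]

theorem exists_rowBlock_eq {β m : ℕ} {A : Matrix (Fin (gammaTwo β)) (Fin m × Fin (gammaTwo β)) ℂ}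
    (h : ∀ k, (fun a b => A a (k, b) : Matrix _ _ ℂ) ∈ blockSpace β) :
    ∃ v : Fin m × Fin β → ℝ, rowBlock v = A := by
  choose c hc using fun k => mem_blockSpace.1 (h k)
  refine ⟨fun p => c p.1 p.2, ?_⟩
  ext a ⟨k, b⟩
  exact congrFun (congrFun (hc k) a) b

/-- Rows of numbers are stable under right multiplication by `Herm(β, m)`. -/
theorem exists_rowBlock_mul_hermMatrix_eq {β m : ℕ} (hβ : β = 1 ∨ β = 2 ∨ β = 4) (v : Fin m × Fin β → ℝ)
    (z : HermCoord β m) : ∃ w : Fin m × Fin β → ℝ, rowBlock v * hermMatrix β m z = rowBlock w := by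
  obtain ⟨w, hw⟩ := exists_rowBlock_eq (A := rowBlock v * hermMatrix β m z) fun k => by
    have : (fun a b => (rowBlock v * hermMatrix β m z) a (k, b) : Matrix _ _ ℂ)
        = ∑ j, numberBlock β (fun l => v (j, l)) * blockAt (hermMatrix β m z) j k := by
      ext a b
      simp [Matrix.mul_apply, Fintype.sum_prod_type, Matrix.sum_apply, rowBlock, blockAt]
    rw [this]
    exact Submodule.sum_mem _ fun j _ =>
      mul_mem_blockSpace hβ (numberBlock_mem _ _) (blockAt_hermMatrix_mem hβ _ _ _)
  exact ⟨w, hw.symm⟩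

theorem rowBlock_mul_conjTranspose_mem {β m : ℕ} (hβ : β = 1 ∨ β = 2 ∨ β = 4)
    (v w : Fin m × Fin β → ℝ) : rowBlock v * (rowBlock w)ᴴ ∈ blockSpace β := by
  have : rowBlock v * (rowBlock w)ᴴ
      = ∑ j, numberBlock β (fun l => v (j, l)) * (numberBlock β (fun l => w (j, l)))ᴴ := by
    ext a b
    simp [Matrix.mul_apply, Fintype.sum_prod_type, Matrix.sum_apply, rowBlock]
  rw [this]
  exact Submodule.sum_mem _ fun j _ => mul_mem_blockSpace hβ (numberBlock_mem _ _)
    (conjTranspose_mem_blockSpace hβ (numberBlock_mem _ _))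

theorem trace_rowBlock {β m : ℕ} (hβ : β = 1 ∨ β = 2 ∨ β = 4) (v w : Fin m × Fin β → ℝ) :
    (rowBlock v * (rowBlock w)ᴴ).trace + (rowBlock w * (rowBlock v)ᴴ).trace
      = (gammaTwo β : ℂ) * (2 * ∑ p, v p * w p : ℝ) := by
  have key : ∀ v w : Fin m × Fin β → ℝ, rowBlock v * (rowBlock w)ᴴ
      = ∑ j, numberBlock β (fun l => v (j, l)) * (numberBlock β (fun l => w (j, l)))ᴴ := by
    intro v w
    ext a b
    simp [Matrix.mul_apply, Fintype.sum_prod_type, Matrix.sum_apply, rowBlock]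
  rw [key, key, Matrix.trace_sum, Matrix.trace_sum, ← Finset.sum_add_distrib,
    Finset.sum_congr rfl fun j _ => trace_numberBlock_mul_conjTranspose hβ _ _, ← Finset.mul_sum,
    Fintype.sum_prod_type]
  push_cast
  simp only [Finset.mul_sum]

/-- The rank-one matrix `v* v` of a row `v` lies in `Herm(β, m)`. -/
theorem exists_hermMatrix_eq_conjTranspose_mul {β m : ℕ} (hβ : β = 1 ∨ β = 2 ∨ β = 4)
    (v : Fin m × Fin β → ℝ) : ∃ q, hermMatrix β m q = (rowBlock v)ᴴ * rowBlock v := by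
  refine exists_hermMatrix_eq hβ (Matrix.isHermitian_conjTranspose_mul_self _) fun j k => ?_
  exact mul_mem_blockSpace hβ
    (conjTranspose_mem_blockSpace hβ (numberBlock_mem β (fun l => v (j, l))))
    (numberBlock_mem β (fun l => v (k, l)))

/-- `rowBlock` as a real linear map. -/
noncomputable def rowBlockL (β m : ℕ) : (Fin m × Fin β → ℝ) →ₗ[ℝ]
    Matrix (Fin (gammaTwo β)) (Fin m × Fin (gammaTwo β)) ℂ where
  toFun := rowBlock
  map_add' v w := by
    ext a p
    exact congrFun (congrFun (numberBlock_add β (fun l => v (p.1, l)) (fun l => w (p.1, l))) a) p.2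
  map_smul' t v := by
    ext a p
    exact congrFun (congrFun (numberBlock_smul β t (fun l => v (p.1, l))) a) p.2

theorem rowBlock_add {β m : ℕ} (v w : Fin m × Fin β → ℝ) :
    rowBlock (v + w) = rowBlock v + rowBlock w := (rowBlockL β m).map_add v w

theorem rowBlock_injective {β m : ℕ} (hβ : β = 1 ∨ β = 2 ∨ β = 4) :
    Function.Injective (rowBlock : (Fin m × Fin β → ℝ) → _) := by
  suffices ∀ v : Fin m × Fin β → ℝ, rowBlock v = 0 → v = 0 by
    refine (injective_iff_map_eq_zero (rowBlockL β m)).2 this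
  intro v hv
  have h := trace_rowBlock hβ v v
  rw [hv] at h
  have hg : (gammaTwo β : ℂ) ≠ 0 := by exact_mod_cast (gammaTwo_pos β).ne'
  simp only [Matrix.zero_mul, Matrix.trace_zero, add_zero, zero_eq_mul, hg, false_or] at h
  have h : 2 * ∑ p, v p * v p = 0 := by exact_mod_cast h
  have h2 := (Finset.sum_eq_zero_iff_of_nonneg (fun p _ => mul_self_nonneg (v p))).1
    (by linarith : ∑ p, v p * v p = 0)
  funext p
  simpa using h2 p (Finset.mem_univ p)

/-! ### Bordering a self-adjoint matrix -/

/-- The parameters of a matrix of size `m + 1`: its corner, its first row, and the rest. -/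
noncomputable def hermIdxSplit (β m : ℕ) :
    (Unit ⊕ (Fin m × Fin β)) ⊕ HermIdx β m ≃ HermIdx β (m + 1) :=
  Equiv.ofBijective
    (Sum.elim
      (Sum.elim (fun _ => Sum.inl 0) (fun p => Sum.inr (⟨(0, p.1.succ), Fin.succ_pos _⟩, p.2)))
      (Sum.elim (fun j => Sum.inl j.succ)
        (fun q => Sum.inr (⟨(q.1.1.1.succ, q.1.1.2.succ), Fin.succ_lt_succ_iff.2 q.1.2⟩, q.2))))
    (by
      constructor
      · rintro ((_ | ⟨j, l⟩) | (j | ⟨⟨⟨j, k⟩, h⟩, l⟩)) ((_ | ⟨j', l'⟩) | (j' | ⟨⟨⟨j', k'⟩, h'⟩, l'⟩)) <;>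
          simp [Fin.succ_ne_zero, (Fin.succ_ne_zero _).symm]
      · rintro (j | ⟨⟨⟨j, k⟩, h⟩, l⟩)
        · rcases Fin.eq_zero_or_eq_succ j with rfl | ⟨i, rfl⟩
          · exact ⟨Sum.inl (Sum.inl ()), rfl⟩
          · exact ⟨Sum.inr (Sum.inl i), rfl⟩
        · obtain ⟨k, rfl⟩ := Fin.exists_succ_eq.2 (Fin.pos_iff_ne_zero.1 ((Fin.zero_le j).trans_lt h))
          rcases Fin.eq_zero_or_eq_succ j with rfl | ⟨i, rfl⟩
          · exact ⟨Sum.inl (Sum.inr (k, l)), rfl⟩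
          · exact ⟨Sum.inr (Sum.inr (⟨(i, k), Fin.succ_lt_succ_iff.1 h⟩, l)), rfl⟩)

/-- The self-adjoint matrix of size `m + 1` with corner `r`, first row `v` and remaining
block `t`. -/
noncomputable def border {β m : ℕ} (r : ℝ) (v : Fin m × Fin β → ℝ) (t : HermCoord β m) :
    HermCoord β (m + 1) :=
  fun i => Sum.elim (Sum.elim (fun _ => r) v) t ((hermIdxSplit β m).symm i)

theorem border_apply {β m : ℕ} (r : ℝ) (v : Fin m × Fin β → ℝ) (t : HermCoord β m)
    (s : (Unit ⊕ (Fin m × Fin β)) ⊕ HermIdx β m) :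
    border r v t (hermIdxSplit β m s) = Sum.elim (Sum.elim (fun _ => r) v) t s := by
  simp [border]

theorem exists_border_eq {β m : ℕ} (x : HermCoord β (m + 1)) :
    ∃ r v t, x = border (m := m) r v t := by
  refine ⟨x (Sum.inl 0), fun p => x (hermIdxSplit β m (Sum.inl (Sum.inr p))),
    fun i => x (hermIdxSplit β m (Sum.inr i)), ?_⟩
  funext i
  obtain ⟨s, rfl⟩ := (hermIdxSplit β m).surjective i
  rw [border_apply]
  rcases s with (_ | p) | i <;> rfl

/-- Splitting off the first block row. -/
def blockIdxSplit (m g : ℕ) : Fin g ⊕ (Fin m × Fin g) ≃ Fin (m + 1) × Fin g where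
  toFun := Sum.elim (fun a => (0, a)) (fun p => (p.1.succ, p.2))
  invFun p := Fin.cases (Sum.inl p.2) (fun j => Sum.inr (j, p.2)) p.1
  left_inv := by rintro (a | ⟨j, a⟩) <;> rfl
  right_inv := by
    rintro ⟨j, a⟩
    rcases Fin.eq_zero_or_eq_succ j with rfl | ⟨i, rfl⟩ <;> rfl

/-- `border r v t` is the block matrix `[[r, v], [v*, t]]`. -/
theorem hermMatrix_border {β m : ℕ} (r : ℝ) (v : Fin m × Fin β → ℝ) (t : HermCoord β m) :
    (hermMatrix β (m + 1) (border r v t)).submatrix (blockIdxSplit m (gammaTwo β))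
        (blockIdxSplit m (gammaTwo β)) =
      fromBlocks ((r : ℂ) • 1) (rowBlock v) (rowBlock v)ᴴ (hermMatrix β m t) := by
  have h1 : border r v t (Sum.inl 0) = r := border_apply r v t (Sum.inl (Sum.inl ()))
  have h2 : ∀ (j : Fin m) (l : Fin β),
      border r v t (Sum.inr (⟨(0, j.succ), Fin.succ_pos _⟩, l)) = v (j, l) :=
    fun j l => border_apply r v t (Sum.inl (Sum.inr (j, l)))
  have h3 : ∀ (j : Fin m), border r v t (Sum.inl j.succ) = t (Sum.inl j) :=
    fun j => border_apply r v t (Sum.inr (Sum.inl j))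
  have h4 : ∀ (j k : Fin m) (h : j < k) (h' : j.succ < k.succ) (l : Fin β),
      border r v t (Sum.inr (⟨(j.succ, k.succ), h'⟩, l)) = t (Sum.inr (⟨(j, k), h⟩, l)) :=
    fun j k h _ l => border_apply r v t (Sum.inr (Sum.inr (⟨(j, k), h⟩, l)))
  ext (a | ⟨j, a⟩) (b | ⟨k, b⟩)
  · change hermMatrix β (m + 1) (border r v t) (0, a) (0, b) = (r : ℂ) * (1 : Matrix _ _ ℂ) a b
    rw [hermMatrix_diag, h1, Matrix.one_apply]
    split_ifs <;> simp
  · change hermMatrix β (m + 1) (border r v t) (0, a) (k.succ, b) = rowBlock v a (k, b)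
    refine (dif_pos (Fin.succ_pos k)).trans ?_
    simp only [rowBlock]
    congr 1
    funext l
    exact h2 k l
  · change hermMatrix β (m + 1) (border r v t) (j.succ, a) (0, b) = star (rowBlock v b (j, a))
    refine (dif_neg (Fin.not_lt_zero _)).trans ((dif_pos (Fin.succ_pos j)).trans ?_)
    simp only [rowBlock]
    congr 2
    funext l
    exact h2 j l
  · change hermMatrix β (m + 1) (border r v t) (j.succ, a) (k.succ, b) =
      hermMatrix β m t (j, a) (k, b)
    rcases lt_trichotomy j k with h | rfl | h
    · refine (dif_pos (Fin.succ_lt_succ_iff.2 h)).trans (Eq.trans ?_ (dif_pos h).symm)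
      congr 1
      funext l
      exact h4 j k h _ l
    · rw [hermMatrix_diag, hermMatrix_diag, h3]
    · refine (dif_neg (Fin.succ_lt_succ_iff.2 h).not_gt).trans
        ((dif_pos (Fin.succ_lt_succ_iff.2 h)).trans (Eq.trans ?_
          ((dif_neg h.not_gt).trans (dif_pos h)).symm))
      congr 2
      funext l
      exact h4 k j h _ l

theorem hermMatrix_add (β m : ℕ) (x y : HermCoord β m) :
    hermMatrix β m (x + y) = hermMatrix β m x + hermMatrix β m y := by
  refine herm_ext (hermMatrix_isHermitian _ _ _)
    ((hermMatrix_isHermitian _ _ _).add (hermMatrix_isHermitian _ _ _)) fun j k a b hjk => ?_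
  rw [Matrix.add_apply]
  rcases hjk.lt_or_eq with h | rfl
  · simp only [hermMatrix, h, dif_pos]
    exact congrFun (congrFun (numberBlock_add β (fun l => x (Sum.inr (⟨(j, k), h⟩, l)))
      (fun l => y (Sum.inr (⟨(j, k), h⟩, l)))) a) b
  · simp only [hermMatrix_diag]
    split_ifs <;> simp

theorem hermMatrix_smul (β m : ℕ) (c : ℝ) (x : HermCoord β m) :
    hermMatrix β m (c • x) = (c : ℂ) • hermMatrix β m x := by
  refine herm_ext (hermMatrix_isHermitian _ _ _)
    ((hermMatrix_isHermitian _ _ _).smul (k := (c : ℂ)) (by simp [IsSelfAdjoint])) fun j k a b hjk => ?_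
  rw [Matrix.smul_apply, smul_eq_mul]
  rcases hjk.lt_or_eq with h | rfl
  · simp only [hermMatrix, h, dif_pos]
    exact (congrFun (congrFun (numberBlock_smul β c (fun l => x (Sum.inr (⟨(j, k), h⟩, l)))) a)
      b).trans (Complex.real_smul ..)
  · simp only [hermMatrix_diag]
    split_ifs <;> simp

/-- The quadratic form `v ↦ v Z v*` on rows of numbers. -/
noncomputable def rowForm {β m : ℕ} (z : HermCoord β m) (v : Fin m × Fin β → ℝ) : ℝ :=
  (rowBlock v * hermMatrix β m z * (rowBlock v)ᴴ).trace.re / gammaTwo β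

theorem rowBlock_mul_mul_conjTranspose {β m : ℕ} (hβ : β = 1 ∨ β = 2 ∨ β = 4)
    (z : HermCoord β m) (v : Fin m × Fin β → ℝ) :
    rowBlock v * hermMatrix β m z * (rowBlock v)ᴴ = (rowForm z v : ℂ) • 1 := by
  obtain ⟨t, ht⟩ : ∃ t : ℝ, rowBlock v * hermMatrix β m z * (rowBlock v)ᴴ = (t : ℂ) • 1 := by
    refine eq_smul_one_of_mem_blockSpace hβ ?_
      (Matrix.isHermitian_mul_mul_conjTranspose _ (hermMatrix_isHermitian β m z))
    obtain ⟨w, hw⟩ := exists_rowBlock_mul_hermMatrix_eq hβ v z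
    rw [hw]
    exact rowBlock_mul_conjTranspose_mem hβ w v
  have hg : (gammaTwo β : ℝ) ≠ 0 := by exact_mod_cast (gammaTwo_pos β).ne'
  rw [rowForm, ht, trace_smul_one]
  congr 1
  rw [← Complex.ofReal_natCast, ← Complex.ofReal_mul, Complex.ofReal_re]
  field_simp

theorem trace_conjTranspose_rowBlock {β m : ℕ} (hβ : β = 1 ∨ β = 2 ∨ β = 4)
    (z : HermCoord β m) (v : Fin m × Fin β → ℝ) :
    ((rowBlock v)ᴴ * rowBlock v * hermMatrix β m z).trace = gammaTwo β * rowForm z v := by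
  rw [← trace_smul_one, ← rowBlock_mul_mul_conjTranspose hβ, Matrix.mul_assoc, Matrix.trace_mul_comm]

theorem trace_submatrix_equiv_self {ι κ : Type*} [Fintype ι] [Fintype κ] (A : Matrix ι ι ℂ)
    (e : κ ≃ ι) : (A.submatrix e e).trace = A.trace := by
  simp only [Matrix.trace, Matrix.diag, Matrix.submatrix_apply]
  exact e.sum_comp (fun i => A i i)

theorem trace_fromBlocks {ι κ : Type*} [Fintype ι] [Fintype κ] (A : Matrix ι ι ℂ)
    (B : Matrix ι κ ℂ) (C : Matrix κ ι ℂ) (D : Matrix κ κ ℂ) :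
    (fromBlocks A B C D).trace = A.trace + D.trace := by
  simp [Matrix.trace]

theorem trace_border {β m : ℕ} (hβ : β = 1 ∨ β = 2 ∨ β = 4) (r r' : ℝ)
    (v v' : Fin m × Fin β → ℝ) (t t' : HermCoord β m) :
    (hermMatrix β (m + 1) (border r v t) * hermMatrix β (m + 1) (border r' v' t')).trace =
      gammaTwo β * ((r * r' + 2 * ∑ p, v p * v' p : ℝ) : ℂ) +
        (hermMatrix β m t * hermMatrix β m t').trace := by
  rw [← trace_submatrix_equiv_self _ (blockIdxSplit m (gammaTwo β)),
    ← Matrix.submatrix_mul_equiv _ _ _ (blockIdxSplit m (gammaTwo β)), hermMatrix_border,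
    hermMatrix_border, Matrix.fromBlocks_multiply, trace_fromBlocks, Matrix.trace_add,
    Matrix.trace_add]
  have h := trace_rowBlock hβ v v'
  rw [Matrix.trace_mul_comm (rowBlock v') _] at h
  have h1 : (((r : ℂ) • 1 : Matrix (Fin (gammaTwo β)) (Fin (gammaTwo β)) ℂ) *
      ((r' : ℂ) • 1)).trace = gammaTwo β * (r * r') := by
    rw [Matrix.smul_mul, Matrix.one_mul, smul_smul, trace_smul_one]
  rw [h1]
  push_cast at h ⊢
  linear_combination h

theorem weight_hermIdxSplit {β m : ℕ} (s : (Unit ⊕ (Fin m × Fin β)) ⊕ HermIdx β m) :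
    (Sum.elim (fun _ => 1) (fun _ => 2) (hermIdxSplit β m s) : ℝ) =
      Sum.elim (Sum.elim (fun _ => 1) (fun _ => 2)) (Sum.elim (fun _ => 1) (fun _ => 2)) s := by
  rcases s with (_ | p) | (j | p) <;> rfl

/-- The trace form in coordinates: diagonal parameters have weight `γ₂`, the others `2 γ₂`. -/
theorem trace_hermMatrix_mul {β m : ℕ} (hβ : β = 1 ∨ β = 2 ∨ β = 4) (x y : HermCoord β m) :
    (hermMatrix β m x * hermMatrix β m y).trace =
      ((∑ i, (gammaTwo β * Sum.elim (fun _ => 1) (fun _ => 2) i : ℝ) * (x i * y i) : ℝ) : ℂ) := by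
  induction m with
  | zero => simp [Matrix.trace]
  | succ m ih =>
    obtain ⟨r, v, t, rfl⟩ := exists_border_eq x
    obtain ⟨r', v', t', rfl⟩ := exists_border_eq y
    rw [trace_border hβ, ih, ← (hermIdxSplit β m).sum_comp]
    simp only [border_apply, weight_hermIdxSplit, Fintype.sum_sum_type, Sum.elim_inl, Sum.elim_inr]
    push_cast
    simp only [Finset.univ_unique, Finset.sum_singleton, mul_add, Finset.mul_sum, mul_assoc, mul_one]

theorem det_smul_one_block {β : ℕ} (r : ℂ) :
    ((r • 1 : Matrix (Fin (gammaTwo β)) (Fin (gammaTwo β)) ℂ)).det = r ^ gammaTwo β := by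
  simp

theorem posDef_submatrix_iff {ι κ : Type*} [Fintype ι] [Fintype κ] (A : Matrix ι ι ℂ)
    (e : κ ≃ ι) : (A.submatrix e e).PosDef ↔ A.PosDef := by
  refine ⟨fun h => ?_, fun h => h.submatrix e.injective⟩
  simpa using h.submatrix e.symm.injective

theorem smul_one_posDef {ι : Type*} [Fintype ι] [DecidableEq ι] {r : ℝ} (hr : 0 < r) :
    ((r : ℂ) • 1 : Matrix ι ι ℂ).PosDef :=
  Matrix.PosDef.one.smul (by exact_mod_cast hr)

/-- The Schur complement `t - v* v / r` of the corner `r` governs the determinant and the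
positivity of `[[r, v], [v*, t]]`; `q` stands for `v* v`. -/
theorem det_border_and_posDef_border_iff {β m : ℕ} {r : ℝ} (hr : r ≠ 0) (v : Fin m × Fin β → ℝ)
    (t q : HermCoord β m) (hq : hermMatrix β m q = (rowBlock v)ᴴ * rowBlock v) :
    (hermMatrix β (m + 1) (border r v t)).det =
      r ^ gammaTwo β * (hermMatrix β m (t - r⁻¹ • q)).det ∧
    (0 < r → ((hermMatrix β (m + 1) (border r v t)).PosDef ↔
      (hermMatrix β m (t - r⁻¹ • q)).PosDef)) := by
  have hu : IsUnit ((r : ℂ) • 1 : Matrix (Fin (gammaTwo β)) (Fin (gammaTwo β)) ℂ) := by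
    rw [Matrix.isUnit_iff_isUnit_det, det_smul_one_block]
    exact IsUnit.pow _ (by simpa using hr)
  let := hu.invertible
  have hinv : ((r : ℂ) • 1 : Matrix (Fin (gammaTwo β)) (Fin (gammaTwo β)) ℂ)⁻¹
      = ((r : ℂ)⁻¹) • 1 := by
    apply Matrix.inv_eq_right_inv
    rw [Matrix.smul_mul, Matrix.one_mul, smul_smul, mul_inv_cancel₀ (by simpa using hr), one_smul]
  have hS : hermMatrix β m t - (rowBlock v)ᴴ *
      ((r : ℂ) • 1 : Matrix (Fin (gammaTwo β)) (Fin (gammaTwo β)) ℂ)⁻¹ * rowBlock v =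
      hermMatrix β m (t - r⁻¹ • q) := by
    rw [hinv, sub_eq_add_neg t, ← neg_smul, hermMatrix_add, hermMatrix_smul, hq]
    simp [sub_eq_add_neg]
  have hdet : (hermMatrix β (m + 1) (border r v t)).det =
      r ^ gammaTwo β * (hermMatrix β m (t - r⁻¹ • q)).det := by
    rw [← Matrix.det_submatrix_equiv_self (blockIdxSplit m (gammaTwo β)), hermMatrix_border,
      Matrix.det_fromBlocks₁₁, Matrix.invOf_eq_nonsing_inv, hS, det_smul_one_block]
  refine ⟨hdet, fun hr0 => ?_⟩
  have hps : (hermMatrix β (m + 1) (border r v t)).PosSemidef ↔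
      (hermMatrix β m (t - r⁻¹ • q)).PosSemidef := by
    rw [← Matrix.posSemidef_submatrix_equiv (blockIdxSplit m (gammaTwo β)), hermMatrix_border,
      Matrix.PosDef.fromBlocks₁₁ _ _ (smul_one_posDef hr0), hS]
  have hz : (hermMatrix β (m + 1) (border r v t)).det ≠ 0 ↔
      (hermMatrix β m (t - r⁻¹ • q)).det ≠ 0 := by
    rw [hdet]; simp [hr]
  constructor
  · intro h
    exact (hps.1 h.posSemidef).posDef_iff_det_ne_zero.2
      (hz.1 (h.posSemidef.posDef_iff_det_ne_zero.1 h))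
  · intro h
    exact (hps.2 h.posSemidef).posDef_iff_det_ne_zero.2
      (hz.2 (h.posSemidef.posDef_iff_det_ne_zero.1 h))

theorem pos_of_posDef_border {β m : ℕ} {r : ℝ} {v : Fin m × Fin β → ℝ} {t : HermCoord β m}
    (h : (hermMatrix β (m + 1) (border r v t)).PosDef) :
    0 < r ∧ (hermMatrix β m t).PosDef := by
  have h' := (posDef_submatrix_iff _ (blockIdxSplit m (gammaTwo β))).2 h
  rw [hermMatrix_border] at h'
  constructor
  · have := h'.diag_pos (i := Sum.inl 0)
    simpa using this
  · exact h'.submatrix (e := Sum.inr) Sum.inr_injective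

/-- Expansion of the determinant along the trailing block, for a border written as `η Z`. -/
theorem exists_row_of_posDef_border {β m : ℕ} (hβ : β = 1 ∨ β = 2 ∨ β = 4) {z : ℝ}
    {ζ : Fin m × Fin β → ℝ} {t : HermCoord β m}
    (h : (hermMatrix β (m + 1) (border z ζ t)).PosDef) :
    ∃ η : Fin m × Fin β → ℝ, rowBlock η * hermMatrix β m t = rowBlock ζ ∧ 0 < z - rowForm t η ∧
      (hermMatrix β (m + 1) (border z ζ t)).det =
        (z - rowForm t η : ℝ) ^ gammaTwo β * (hermMatrix β m t).det := by
  have ht := (pos_of_posDef_border h).2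
  have hu := ht.isUnit
  have hdetu := (Matrix.isUnit_iff_isUnit_det _).1 hu
  choose T hT using fun v => exists_rowBlock_mul_hermMatrix_eq hβ v t
  -- right multiplication by `t` is an injective endomorphism of a finite-dimensional space
  let L : (Fin m × Fin β → ℝ) →ₗ[ℝ] (Fin m × Fin β → ℝ) :=
    { toFun := T
      map_add' := fun v w => by
        apply rowBlock_injective hβ
        rw [← hT, rowBlock_add, rowBlock_add, Matrix.add_mul, hT, hT]
      map_smul' := fun c v => by
        apply rowBlock_injective hβ
        rw [← hT]
        refine Eq.trans ?_ ((rowBlockL β m).map_smul c (T v)).symm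
        change rowBlockL β m (c • v) * _ = c • rowBlock (T v)
        rw [map_smul, Matrix.smul_mul]
        exact congrArg (c • ·) (hT v) }
  have hLi : Function.Injective L := by
    intro v w hvw
    apply rowBlock_injective hβ
    have : rowBlock v * hermMatrix β m t = rowBlock w * hermMatrix β m t := by
      rw [hT, hT]; exact congrArg rowBlock hvw
    rw [← Matrix.mul_nonsing_inv_cancel_right _ (rowBlock v) hdetu, this,
      Matrix.mul_nonsing_inv_cancel_right _ (rowBlock w) hdetu]
  obtain ⟨η, hη⟩ := (LinearMap.injective_iff_surjective.1 hLi) ζ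
  have hη' : rowBlock η * hermMatrix β m t = rowBlock ζ := by
    rw [hT]; exact congrArg rowBlock hη
  let := hu.invertible
  have hS : ((z : ℂ) • 1 : Matrix (Fin (gammaTwo β)) (Fin (gammaTwo β)) ℂ) -
      rowBlock ζ * (hermMatrix β m t)⁻¹ * (rowBlock ζ)ᴴ = ((z - rowForm t η : ℝ) : ℂ) • 1 := by
    have : rowBlock ζ * (hermMatrix β m t)⁻¹ * (rowBlock ζ)ᴴ = (rowForm t η : ℂ) • 1 := by
      rw [← rowBlock_mul_mul_conjTranspose hβ, ← hη', Matrix.conjTranspose_mul,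
        (hermMatrix_isHermitian β m t).eq]
      simp only [Matrix.mul_assoc, Matrix.mul_nonsing_inv_cancel_left _ _ hdetu]
    rw [this, ← sub_smul]; push_cast; rfl
  have hdet : (hermMatrix β (m + 1) (border z ζ t)).det =
        (z - rowForm t η : ℝ) ^ gammaTwo β * (hermMatrix β m t).det := by
    rw [← Matrix.det_submatrix_equiv_self (blockIdxSplit m (gammaTwo β)), hermMatrix_border,
      Matrix.det_fromBlocks₂₂, Matrix.invOf_eq_nonsing_inv, hS, det_smul_one_block, mul_comm]
  refine ⟨η, hη', ?_, hdet⟩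
  have hps := h.posSemidef
  rw [← Matrix.posSemidef_submatrix_equiv (blockIdxSplit m (gammaTwo β)), hermMatrix_border,
    Matrix.PosDef.fromBlocks₂₂ _ _ ht, hS] at hps
  have h0 : 0 ≤ z - rowForm t η := by
    have := hps.diag_nonneg (i := 0)
    rw [Matrix.smul_apply, Matrix.one_apply_eq, smul_eq_mul, mul_one] at this
    exact_mod_cast this
  refine lt_of_le_of_ne h0 fun h1 => ?_
  rw [← h1] at hdet
  have := h.det_pos.ne'
  rw [hdet] at this
  simp [(gammaTwo_pos β).ne'] at this

/-! ### The cone of positive definite matrices -/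

theorem continuous_hermMatrix (β m : ℕ) : Continuous (hermMatrix β m) := by
  let L : HermCoord β m →ₗ[ℝ] BlockMatrix β m :=
    { toFun := hermMatrix β m
      map_add' := hermMatrix_add β m
      map_smul' := fun c x => (hermMatrix_smul β m c x).trans (by
        ext p q; simp) }
  exact L.continuous_of_finiteDimensional

theorem isOpen_posDef (β m : ℕ) : IsOpen {x : HermCoord β m | (hermMatrix β m x).PosDef} := by
  rw [isOpen_iff_mem_nhds]
  intro x hx
  let E := Fin m × Fin (gammaTwo β) → ℂ
  let Q : HermCoord β m → E → ℝ := fun y w => (star w ⬝ᵥ (hermMatrix β m y *ᵥ w)).re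
  have hQ : Continuous fun p : HermCoord β m × E => Q p.1 p.2 := by
    have h1 := (continuous_hermMatrix β m).comp (continuous_fst (X := HermCoord β m) (Y := E))
    exact Complex.continuous_re.comp
      (continuous_snd.star.dotProduct (h1.matrix_mulVec continuous_snd))
  -- positivity of the form on the compact unit sphere is an open condition
  have hev : ∀ᶠ y in nhds x, ∀ w ∈ Metric.sphere (0 : E) 1, 0 < Q y w := by
    refine (isCompact_sphere (0 : E) 1).eventually_forall_of_forall_eventually fun w hw => ?_
    refine hQ.continuousAt.eventually (lt_mem_nhds ?_)
    have hw0 : w ≠ 0 := by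
      rintro rfl
      simp at hw
    exact (Complex.lt_def.1 (hx.dotProduct_mulVec_pos hw0)).1
  filter_upwards [hev] with y hy
  refine Matrix.PosDef.of_dotProduct_mulVec_pos (hermMatrix_isHermitian β m y) fun w hw0 => ?_
  have hn : (‖w‖ : ℝ) ≠ 0 := norm_ne_zero_iff.2 hw0
  have h := hy ((‖w‖⁻¹ : ℝ) • w) (by simp [norm_smul, hn])
  have hsc : Q y ((‖w‖⁻¹ : ℝ) • w) = ‖w‖⁻¹ ^ 2 * Q y w := by
    simp only [Q, star_smul, smul_dotProduct, Matrix.mulVec_smul, dotProduct_smul]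
    simp; ring
  rw [hsc] at h
  have hq : 0 < Q y w := pos_of_mul_pos_right h (by positivity)
  rw [Complex.lt_def]
  refine ⟨hq, ?_⟩
  have := (hermMatrix_isHermitian β m y).im_star_dotProduct_mulVec_self w
  exact this.symm

theorem isClosed_posSemidef (β m : ℕ) :
    IsClosed {x : HermCoord β m | (hermMatrix β m x).PosSemidef} := by
  have : {x : HermCoord β m | (hermMatrix β m x).PosSemidef} =
      ⋂ w : Fin m × Fin (gammaTwo β) → ℂ,
        {x | 0 ≤ star w ⬝ᵥ (hermMatrix β m x *ᵥ w)} := by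
    ext x
    simp only [Set.mem_iInter, Set.mem_ofPred_eq]
    exact ⟨fun h w => h.dotProduct_mulVec_nonneg w, fun h =>
      Matrix.PosSemidef.of_dotProduct_mulVec_nonneg (hermMatrix_isHermitian β m x) h⟩
  rw [this]
  refine isClosed_iInter fun w => isClosed_le continuous_const ?_
  exact continuous_const.dotProduct ((continuous_hermMatrix β m).matrix_mulVec continuous_const)

theorem measurableSet_posDef (β m : ℕ) :
    MeasurableSet {x : HermCoord β m | (hermMatrix β m x).PosDef} :=
  (isOpen_posDef β m).measurableSet

/-- The real determinant of a self-adjoint matrix. -/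
noncomputable def hermDet {β m : ℕ} (x : HermCoord β m) : ℝ := (hermMatrix β m x).det.re

theorem det_hermMatrix {β m : ℕ} (x : HermCoord β m) :
    (hermMatrix β m x).det = (hermDet x : ℂ) := by
  have h : star (hermMatrix β m x).det = (hermMatrix β m x).det := by
    rw [← Matrix.det_conjTranspose, (hermMatrix_isHermitian β m x).eq]
  exact (Complex.conj_eq_iff_re.1 h).symm

theorem continuous_hermDet (β m : ℕ) : Continuous (hermDet : HermCoord β m → ℝ) :=
  Complex.continuous_re.comp (continuous_hermMatrix β m).matrix_det

theorem hermDet_pos {β m : ℕ} {x : HermCoord β m} (h : (hermMatrix β m x).PosDef) :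
    0 < hermDet x := by
  have := h.det_pos
  rw [det_hermMatrix] at this
  exact_mod_cast this

/-- The trace form `tr (X Z)`. -/
noncomputable def traceForm {β m : ℕ} (x z : HermCoord β m) : ℝ :=
  (hermMatrix β m x * hermMatrix β m z).trace.re

theorem trace_eq_traceForm {β m : ℕ} (hβ : β = 1 ∨ β = 2 ∨ β = 4) (x z : HermCoord β m) :
    (hermMatrix β m x * hermMatrix β m z).trace = (traceForm x z : ℂ) := by
  rw [traceForm, trace_hermMatrix_mul hβ, Complex.ofReal_re]

theorem continuous_traceForm {β m : ℕ} (z : HermCoord β m) :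
    Continuous fun x : HermCoord β m => traceForm x z :=
  Complex.continuous_re.comp
    ((continuous_hermMatrix β m).matrix_mul continuous_const).matrix_trace

theorem traceForm_add_left {β m : ℕ} (x y z : HermCoord β m) :
    traceForm (x + y) z = traceForm x z + traceForm y z := by
  simp [traceForm, hermMatrix_add, Matrix.add_mul]

theorem traceForm_smul_left {β m : ℕ} (c : ℝ) (x z : HermCoord β m) :
    traceForm (c • x) z = c * traceForm x z := by
  simp [traceForm, hermMatrix_smul]

theorem traceForm_comm {β m : ℕ} (x z : HermCoord β m) : traceForm x z = traceForm z x := by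
  rw [traceForm, Matrix.trace_mul_comm]; rfl

/-! ### Gaussian integrals over rows of numbers -/

/-- Tonelli for a product of copies of `ℝ` whose index set is split in two. -/
theorem lintegral_pi_split {ι ι₁ ι₂ : Type*} [Fintype ι] [Fintype ι₁] [Fintype ι₂]
    (e : ι₁ ⊕ ι₂ ≃ ι) {F : (ι → ℝ) → ℝ≥0∞} (hF : Measurable F) :
    ∫⁻ x, F x = ∫⁻ y₁ : ι₁ → ℝ, ∫⁻ y₂ : ι₂ → ℝ, F (fun i => Sum.elim y₁ y₂ (e.symm i)) := by
  have h1 := (volume_measurePreserving_piCongrLeft (fun _ : ι => ℝ) e)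
  have h2 := (volume_measurePreserving_sumPiEquivProdPi_symm (fun _ : ι₁ ⊕ ι₂ => ℝ))
  have h := h1.comp h2
  rw [← h.lintegral_comp hF]
  have hm : Measurable fun a => F ((⇑(MeasurableEquiv.piCongrLeft (fun _ : ι => ℝ) e) ∘
    ⇑(MeasurableEquiv.sumPiEquivProdPi fun _ : ι₁ ⊕ ι₂ => ℝ).symm) a) := hF.comp h.measurable
  refine (MeasureTheory.lintegral_prod _ hm.aemeasurable).trans ?_
  refine lintegral_congr fun y₁ => lintegral_congr fun y₂ => ?_
  congr 1
  funext i
  obtain ⟨s, rfl⟩ := e.surjective i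
  simp only [Function.comp_apply, Equiv.symm_apply_apply]
  refine (Equiv.piCongrLeft_apply_apply (fun _ : ι => ℝ) e _ s).trans ?_
  rcases s with s | s <;> rfl

theorem lintegral_exp_neg_mul_sq (k : ℕ) {t : ℝ} (ht : 0 < t) :
    ∫⁻ v : Fin k → ℝ, ENNReal.ofReal (Real.exp (-(t * ∑ l, v l ^ 2))) =
      ENNReal.ofReal ((Real.pi / t) ^ ((k : ℝ) / 2)) := by
  have hprod : ∀ v : Fin k → ℝ, Real.exp (-(t * ∑ l, v l ^ 2)) =
      ∏ l, Real.exp (-t * v l ^ 2) := by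
    intro v
    rw [← Real.exp_sum, ← Finset.mul_sum]
    ring_nf
  have hint : Integrable fun v : Fin k → ℝ => Real.exp (-(t * ∑ l, v l ^ 2)) := by
    simp_rw [hprod]
    exact Integrable.fintype_prod (f := fun _ (x : ℝ) => Real.exp (-t * x ^ 2))
      (fun _ => integrable_exp_neg_mul_sq ht)
  rw [← ofReal_integral_eq_lintegral_ofReal hint (ae_of_all _ fun v => (Real.exp_pos _).le)]
  congr 1
  simp_rw [hprod]
  rw [integral_fintype_prod_volume_eq_pow (fun x : ℝ => Real.exp (-t * x ^ 2)), integral_gaussian,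
    Real.sqrt_eq_rpow, ← Real.rpow_natCast, ← Real.rpow_mul (by positivity)]
  congr 1
  simp; ring

theorem gammaTwo_mul_rowForm {β m : ℕ} (hβ : β = 1 ∨ β = 2 ∨ β = 4) (z : HermCoord β m)
    (v : Fin m × Fin β → ℝ) : ((gammaTwo β * rowForm z v : ℝ) : ℂ) =
      (rowBlock v * hermMatrix β m z * (rowBlock v)ᴴ).trace := by
  rw [rowBlock_mul_mul_conjTranspose hβ, trace_smul_one]; push_cast; rfl

/-- Expansion of the quadratic form around `η`; the linear part is the row `ζ = η Z`, which allows to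
complete the square in the first row of the Laplace integral. -/
theorem rowForm_add {β m : ℕ} (hβ : β = 1 ∨ β = 2 ∨ β = 4) (z : HermCoord β m)
    {η ζ : Fin m × Fin β → ℝ} (h : rowBlock η * hermMatrix β m z = rowBlock ζ)
    (v : Fin m × Fin β → ℝ) :
    rowForm z (v + η) = rowForm z v + 2 * ∑ p, v p * ζ p + rowForm z η := by
  have hg : (gammaTwo β : ℝ) ≠ 0 := by exact_mod_cast (gammaTwo_pos β).ne'
  have h2 : hermMatrix β m z * (rowBlock η)ᴴ = (rowBlock ζ)ᴴ := by
    rw [← h, Matrix.conjTranspose_mul, (hermMatrix_isHermitian β m z).eq]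
  have ht := trace_rowBlock hβ v ζ
  apply mul_left_cancel₀ hg
  rw [← Complex.ofReal_inj, gammaTwo_mul_rowForm hβ, mul_add, mul_add, Complex.ofReal_add,
    Complex.ofReal_add, gammaTwo_mul_rowForm hβ, gammaTwo_mul_rowForm hβ, rowBlock_add,
    Matrix.conjTranspose_add, Matrix.add_mul, Matrix.add_mul, Matrix.mul_add, Matrix.mul_add,
    Matrix.mul_assoc (rowBlock v) _ (rowBlock η)ᴴ, h2, h, Matrix.trace_add, Matrix.trace_add,
    Matrix.trace_add]
  push_cast at ht ⊢
  linear_combination ht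

theorem rowForm_smul {β m : ℕ} (c : ℝ) (z : HermCoord β m) (v : Fin m × Fin β → ℝ) :
    rowForm (c • z) v = c * rowForm z v := by
  simp [rowForm, hermMatrix_smul, mul_div_assoc]

theorem continuous_rowBlock (β m : ℕ) :
    Continuous (rowBlock : (Fin m × Fin β → ℝ) → _) :=
  (rowBlockL β m).continuous_of_finiteDimensional

theorem continuous_rowForm {β m : ℕ} (z : HermCoord β m) : Continuous (rowForm z) :=
  (Complex.continuous_re.comp (((continuous_rowBlock β m).matrix_mul
    continuous_const).matrix_mul (continuous_rowBlock β m).matrix_conjTranspose).matrix_trace).div_const _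

/-- Completing the square in the first entry of a row. -/
theorem exists_rowForm_border {β m : ℕ} (hβ : β = 1 ∨ β = 2 ∨ β = 4) {t : ℝ} (ht : t ≠ 0)
    (u : Fin m × Fin β → ℝ) (z q : HermCoord β m)
    (hq : hermMatrix β m q = (rowBlock u)ᴴ * rowBlock u) (w : Fin m × Fin β → ℝ) :
    ∃ p : Fin β → ℝ, ∀ c : Fin β → ℝ,
      rowForm (border t u z) (fun i => Sum.elim c w ((blockIdxSplit m β).symm i)) =
        t * (∑ l, (c + t⁻¹ • p) l ^ 2) + rowForm (z - t⁻¹ • q) w := by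
  have hg : (gammaTwo β : ℝ) ≠ 0 := by exact_mod_cast (gammaTwo_pos β).ne'
  obtain ⟨p, hp⟩ := mem_blockSpace.1 (rowBlock_mul_conjTranspose_mem hβ w u)
  refine ⟨p, fun c => ?_⟩
  have hrow : (rowBlock (fun i => Sum.elim c w ((blockIdxSplit m β).symm i))).submatrix id
      (blockIdxSplit m (gammaTwo β)) = fromCols (numberBlock β c) (rowBlock w) := by
    ext a (b | ⟨k, b⟩) <;> rfl
  have hp2 : (numberBlock β p)ᴴ = rowBlock u * (rowBlock w)ᴴ := by
    rw [hp, Matrix.conjTranspose_mul, Matrix.conjTranspose_conjTranspose]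
  have h1 : rowBlock (fun i => Sum.elim c w ((blockIdxSplit m β).symm i)) *
      hermMatrix β (m + 1) (border t u z) *
        (rowBlock (fun i => Sum.elim c w ((blockIdxSplit m β).symm i)))ᴴ =
      (t : ℂ) • (numberBlock β c * (numberBlock β c)ᴴ) +
        numberBlock β p * (numberBlock β c)ᴴ + numberBlock β c * (numberBlock β p)ᴴ +
        rowBlock w * hermMatrix β m z * (rowBlock w)ᴴ := by
    have e : ∀ (A : Matrix (Fin (gammaTwo β)) (Fin (m + 1) × Fin (gammaTwo β)) ℂ)
        (B : BlockMatrix β (m + 1)), A * B * Aᴴ =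
          (A.submatrix id (blockIdxSplit m (gammaTwo β))) *
          (B.submatrix (blockIdxSplit m (gammaTwo β)) (blockIdxSplit m (gammaTwo β))) *
          (A.submatrix id (blockIdxSplit m (gammaTwo β)))ᴴ := by
      intro A B
      rw [Matrix.submatrix_mul_equiv, Matrix.conjTranspose_submatrix, Matrix.submatrix_mul_equiv,
        Matrix.submatrix_id_id]
    rw [e, hrow, hermMatrix_border, Matrix.fromCols_mul_fromBlocks,
      Matrix.conjTranspose_fromCols_eq_fromRows_conjTranspose, Matrix.fromCols_mul_fromRows,
      hp2, hp]
    simp only [Matrix.add_mul, Matrix.mul_smul, Matrix.smul_mul, Matrix.mul_one, Matrix.mul_assoc]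
    abel
  have h2 : rowBlock w * hermMatrix β m (z - t⁻¹ • q) * (rowBlock w)ᴴ =
      rowBlock w * hermMatrix β m z * (rowBlock w)ᴴ -
        ((t : ℂ)⁻¹) • (numberBlock β p * (numberBlock β p)ᴴ) := by
    rw [sub_eq_add_neg z, ← neg_smul, hermMatrix_add, hermMatrix_smul, hq, hp2, hp]
    simp only [Matrix.mul_add, Matrix.add_mul, Matrix.mul_assoc, Matrix.smul_mul, Matrix.mul_smul]
    push_cast
    rw [neg_smul, ← sub_eq_add_neg]
  have h3 := trace_numberBlock_mul_conjTranspose hβ c p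
  have htc : (t : ℂ) ≠ 0 := by exact_mod_cast ht
  apply mul_left_cancel₀ hg
  rw [mul_add, ← Complex.ofReal_inj, gammaTwo_mul_rowForm hβ, h1, Complex.ofReal_add,
    gammaTwo_mul_rowForm hβ, h2, numberBlock_mul_conjTranspose_self hβ,
    numberBlock_mul_conjTranspose_self hβ, Matrix.trace_add, Matrix.trace_add, Matrix.trace_add,
    Matrix.trace_sub, smul_smul, smul_smul, trace_smul_one, trace_smul_one]
  have h4 : ∑ l, (c + t⁻¹ • p) l ^ 2 = ∑ l, c l ^ 2 + 2 * t⁻¹ * ∑ l, c l * p l +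
      t⁻¹ ^ 2 * ∑ l, p l ^ 2 := by
    simp only [Finset.mul_sum, ← Finset.sum_add_distrib]
    refine Finset.sum_congr rfl fun l _ => ?_
    simp; ring
  rw [h4]
  push_cast at h3 ⊢
  field_simp
  linear_combination (t : ℂ) * h3

/-- The Gaussian integral over rows of `m` numbers. -/
theorem lintegral_exp_neg_rowForm {β : ℕ} (hβ : β = 1 ∨ β = 2 ∨ β = 4) {m : ℕ}
    {z : HermCoord β m} (hz : (hermMatrix β m z).PosDef) :
    ∫⁻ v, ENNReal.ofReal (Real.exp (-rowForm z v)) =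
      ENNReal.ofReal (Real.pi ^ ((β : ℝ) * m / 2) * hermDet z ^ (-(β : ℝ) / (2 * gammaTwo β))) := by
  have hg : (gammaTwo β : ℝ) ≠ 0 := by exact_mod_cast (gammaTwo_pos β).ne'
  induction m with
  | zero =>
    rw [volume_pi, Measure.pi_of_empty (x := 0)]
    simp [rowForm, hermDet, Matrix.trace, Matrix.mul_apply]
  | succ m ih =>
    obtain ⟨t, u, z, rfl⟩ := exists_border_eq z
    obtain ⟨q, hq⟩ := exists_hermMatrix_eq_conjTranspose_mul hβ u
    have ht := (pos_of_posDef_border hz).1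
    obtain ⟨hdet, hpd⟩ := det_border_and_posDef_border_iff ht.ne' u z q hq
    have hz' := (hpd ht).1 hz
    have hmeas : Measurable fun v => ENNReal.ofReal (Real.exp (-rowForm (border t u z) v)) :=
      (Real.measurable_exp.comp (continuous_rowForm _).measurable.neg).ennreal_ofReal
    rw [lintegral_pi_split ((Equiv.sumComm _ _).trans (blockIdxSplit m β)) hmeas]
    have key : ∀ w : Fin m × Fin β → ℝ, ∫⁻ c : Fin β → ℝ, ENNReal.ofReal (Real.exp
        (-rowForm (border t u z) (fun i => Sum.elim w c
          (((Equiv.sumComm _ _).trans (blockIdxSplit m β)).symm i)))) =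
        ENNReal.ofReal ((Real.pi / t) ^ ((β : ℝ) / 2)) *
          ENNReal.ofReal (Real.exp (-rowForm (z - t⁻¹ • q) w)) := by
      intro w
      obtain ⟨p, hp⟩ := exists_rowForm_border hβ ht.ne' u z q hq w
      have hswap : ∀ c : Fin β → ℝ, (fun i => Sum.elim w c
          (((Equiv.sumComm _ _).trans (blockIdxSplit m β)).symm i)) =
          fun i => Sum.elim c w ((blockIdxSplit m β).symm i) := by
        intro c
        funext i
        obtain ⟨s, rfl⟩ := (blockIdxSplit m β).surjective i
        rcases s with s | s <;> simp
      simp_rw [hswap, hp, neg_add, Real.exp_add, ENNReal.ofReal_mul (Real.exp_pos _).le]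
      rw [lintegral_mul_const _ (by fun_prop), lintegral_add_right_eq_self
        (fun c : Fin β → ℝ => ENNReal.ofReal (Real.exp (-(t * ∑ l, c l ^ 2)))),
        lintegral_exp_neg_mul_sq β ht]
    simp_rw [key]
    have hmeas2 : Measurable fun v => ENNReal.ofReal (Real.exp (-rowForm (z - t⁻¹ • q) v)) :=
      (Real.measurable_exp.comp (continuous_rowForm _).measurable.neg).ennreal_ofReal
    rw [lintegral_const_mul _ hmeas2, ih hz', ← ENNReal.ofReal_mul (by positivity)]
    congr 1
    have hd : hermDet (border t u z) = t ^ gammaTwo β * hermDet (z - t⁻¹ • q) := by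
      rw [← Complex.ofReal_inj, ← det_hermMatrix, hdet, det_hermMatrix]; push_cast; rfl
    have hd0 := hermDet_pos hz'
    rw [hd, Real.mul_rpow (by positivity) hd0.le, ← Real.rpow_natCast t, ← Real.rpow_mul ht.le,
      Real.div_rpow Real.pi_pos.le ht.le]
    have e1 : (gammaTwo β : ℝ) * (-(β : ℝ) / (2 * gammaTwo β)) = -((β : ℝ) / 2) := by
      field_simp
    have e2 : (β : ℝ) * ((m + 1 : ℕ) : ℝ) / 2 = β / 2 + β * m / 2 := by push_cast; ring
    rw [e1, e2, Real.rpow_add Real.pi_pos, Real.rpow_neg ht.le]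
    ring

/-! ### The Laplace transform of a power of the determinant -/

open Classical in
/-- The power `Δ^e` of the Jordan determinant `Δ = det^(1/γ₂)`, restricted to the cone of positive
definite matrices. -/
noncomputable def conePow {β m : ℕ} (e : ℝ) (x : HermCoord β m) : ℝ :=
  if (hermMatrix β m x).PosDef then hermDet x ^ (e / gammaTwo β) else 0

theorem conePow_nonneg {β m : ℕ} (e : ℝ) (x : HermCoord β m) : 0 ≤ conePow e x := by
  unfold conePow
  split_ifs with h
  · exact Real.rpow_nonneg (hermDet_pos h).le _
  · exact le_rfl

theorem measurable_conePow {β m : ℕ} (e : ℝ) :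
    Measurable (conePow e : HermCoord β m → ℝ) := by
  classical
  exact Measurable.ite (measurableSet_posDef β m)
    ((continuous_hermDet β m).measurable.pow_const _) measurable_const

/-- The Gindikin gamma factor of `Herm(β, m)`, for the trace form `tr` and Lebesgue measure in the
independent parameters. -/
noncomputable def coneGamma (β : ℕ) : ℕ → ℝ → ℝ
  | 0, _ => 1
  | m + 1, a => coneGamma β m (a - β / 2) * (Real.pi / gammaTwo β) ^ ((β : ℝ) * m / 2) *
      ((gammaTwo β : ℝ) ^ (-a) * Real.Gamma a)

theorem lintegral_rpow_mul_exp {a s : ℝ} (ha : 0 < a) (hs : 0 < s) :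
    ∫⁻ r in Set.Ioi (0 : ℝ), ENNReal.ofReal (r ^ (a - 1) * Real.exp (-(s * r))) =
      ENNReal.ofReal (s ^ (-a) * Real.Gamma a) := by
  have h := Real.integral_rpow_mul_exp_neg_mul_Ioi ha hs
  have hpos : 0 < (1 / s) ^ a * Real.Gamma a :=
    mul_pos (by positivity) (Real.Gamma_pos_of_pos ha)
  have hint : IntegrableOn (fun r : ℝ => r ^ (a - 1) * Real.exp (-(s * r))) (Set.Ioi 0) := by
    -- a divergent integral would be `0` by convention, but the value is positive
    by_contra hcon
    rw [integral_undef hcon] at h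
    exact hpos.ne h
  rw [← ofReal_integral_eq_lintegral_ofReal hint, h, one_div, Real.inv_rpow hs.le,
    Real.rpow_neg hs.le]
  filter_upwards [self_mem_ae_restrict measurableSet_Ioi] with r hr
  have : (0 : ℝ) < r := hr
  positivity

theorem measurable_border {β m : ℕ} :
    Measurable fun p : (ℝ × (Fin m × Fin β → ℝ)) × HermCoord β m => border p.1.1 p.1.2 p.2 := by
  refine measurable_pi_iff.2 fun i => ?_
  obtain ⟨s, rfl⟩ := (hermIdxSplit β m).surjective i
  simp only [border_apply]
  rcases s with (_ | p) | j <;> simp only [Sum.elim_inl, Sum.elim_inr] <;> fun_prop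

/-- `d[X] = dr d[v] d[t]` for `X = [[r, v], [v*, t]]`. -/
theorem lintegral_border {β m : ℕ} {F : HermCoord β (m + 1) → ℝ≥0∞} (hF : Measurable F) :
    ∫⁻ x, F x = ∫⁻ r : ℝ, ∫⁻ v : Fin m × Fin β → ℝ, ∫⁻ t : HermCoord β m, F (border r v t) := by
  rw [lintegral_pi_split (hermIdxSplit β m) hF]
  have hm0 : Measurable fun p : (ℝ × (Fin m × Fin β → ℝ)) × HermCoord β m =>
    F (border p.1.1 p.1.2 p.2) := hF.comp measurable_border
  have hG : Measurable fun y : Unit ⊕ (Fin m × Fin β) → ℝ =>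
      ∫⁻ t : HermCoord β m, F (fun i => Sum.elim y t ((hermIdxSplit β m).symm i)) := by
    have : Measurable fun q : (Unit ⊕ (Fin m × Fin β) → ℝ) × HermCoord β m =>
        ((q.1 (Sum.inl ()), fun p => q.1 (Sum.inr p)), q.2) := by fun_prop
    convert (hm0.comp this).lintegral_prod_right' (ν := volume) using 1
    funext y
    refine lintegral_congr fun t => ?_
    simp only [Function.comp]
    congr 1
    funext i
    congr 1
    funext s
    rcases s with _ | _ <;> rfl
  rw [lintegral_pi_split (Equiv.refl _) hG]
  have hp := (volume_preserving_funUnique Unit ℝ).symm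
  have hH : Measurable fun a : Unit → ℝ => ∫⁻ v : Fin m × Fin β → ℝ, ∫⁻ t : HermCoord β m,
      F (border (a ()) v t) := by
    have : Measurable fun q : ((Unit → ℝ) × (Fin m × Fin β → ℝ)) × HermCoord β m =>
        ((q.1.1 (), q.1.2), q.2) := by fun_prop
    exact (hm0.comp this).lintegral_prod_right'.lintegral_prod_right'
  exact (hp.lintegral_comp hH).symm

theorem traceForm_border {β m : ℕ} (hβ : β = 1 ∨ β = 2 ∨ β = 4) (r r' : ℝ)
    (v v' : Fin m × Fin β → ℝ) (t t' : HermCoord β m) :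
    traceForm (border r v t) (border r' v' t') =
      gammaTwo β * (r * r' + 2 * ∑ p, v p * v' p) + traceForm t t' := by
  rw [← Complex.ofReal_inj, ← trace_eq_traceForm hβ, trace_border hβ, trace_eq_traceForm hβ]
  push_cast; rfl

/-- Laplace transform of a power of the determinant over the positive cone, for real arguments.
The Schur complement of the corner separates the variables. -/
theorem lintegral_conePow_mul_exp {β : ℕ} (hβ : β = 1 ∨ β = 2 ∨ β = 4) {m : ℕ} {a : ℝ}
    (ha : ∀ k < m, (β : ℝ) * k / 2 < a) {z : HermCoord β m} (hz : (hermMatrix β m z).PosDef) :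
    ∫⁻ x, ENNReal.ofReal (conePow (a - 1 - β * ((m : ℝ) - 1) / 2) x * Real.exp (-traceForm x z)) =
      ENNReal.ofReal (coneGamma β m a * hermDet z ^ (-a / gammaTwo β)) := by
  have hg : (0 : ℝ) < gammaTwo β := by exact_mod_cast gammaTwo_pos β
  induction m generalizing a with
  | zero =>
    rw [volume_pi, Measure.pi_of_empty (x := 0)]
    have : (hermMatrix β 0 0).PosDef := by
      rw [show (0 : HermCoord β 0) = z from Subsingleton.elim _ _]; exact hz
    simp [conePow, hermDet, coneGamma, traceForm, this, Matrix.trace]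
  | succ m ih =>
    obtain ⟨z₀, ζ, z, rfl⟩ := exists_border_eq z
    obtain ⟨η, hη, hs, hdet⟩ := exists_row_of_posDef_border hβ hz
    have hz' := (pos_of_posDef_border hz).2
    have ha0 : 0 < a := by simpa using ha 0 (Nat.succ_pos m)
    have ha' : ∀ k < m, (β : ℝ) * k / 2 < a - β / 2 := fun k hk => by
      have := ha (k + 1) (Nat.succ_lt_succ hk)
      push_cast at this
      linarith
    have hd0 := hermDet_pos hz'
    set s := z₀ - rowForm z η with hsdef
    have hd : hermDet (border z₀ ζ z) = s ^ gammaTwo β * hermDet z := by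
      rw [← Complex.ofReal_inj, ← det_hermMatrix, hdet, det_hermMatrix]; push_cast; rfl
    set e : ℝ := a - 1 - β * (((m + 1 : ℕ) : ℝ) - 1) / 2 with he
    have he' : e = (a - β / 2) - 1 - β * ((m : ℝ) - 1) / 2 := by rw [he]; push_cast; ring
    have hmeas : Measurable fun x : HermCoord β (m + 1) =>
        ENNReal.ofReal (conePow e x * Real.exp (-traceForm x (border z₀ ζ z))) :=
      ((measurable_conePow e).mul (Real.measurable_exp.comp
        (continuous_traceForm _).measurable.neg)).ennreal_ofReal
    rw [lintegral_border hmeas]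
    set K := ENNReal.ofReal (coneGamma β m (a - β / 2) *
      hermDet z ^ (-(a - β / 2) / gammaTwo β)) with hK
    -- the innermost integral, after the shift by the Schur complement of the corner
    have inner : ∀ r : ℝ, 0 < r → ∀ v : Fin m × Fin β → ℝ,
        ∫⁻ t, ENNReal.ofReal (conePow e (border r v t) *
          Real.exp (-traceForm (border r v t) (border z₀ ζ z))) =
        ENNReal.ofReal (r ^ e * Real.exp (-(gammaTwo β * s * r))) *
          ENNReal.ofReal (Real.exp (-rowForm ((gammaTwo β / r : ℝ) • z) (v + r • η))) * K := by
      intro r hr v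
      obtain ⟨q, hq⟩ := exists_hermMatrix_eq_conjTranspose_mul hβ v
      have hqz : traceForm q z = gammaTwo β * rowForm z v := by
        rw [← Complex.ofReal_inj, ← trace_eq_traceForm hβ, hq, trace_conjTranspose_rowBlock hβ]
        push_cast; rfl
      have hηr : rowBlock (r • η) * hermMatrix β m ((gammaTwo β / r : ℝ) • z) =
          rowBlock ((gammaTwo β : ℝ) • ζ) := by
        have e1 : rowBlock (r • η) = r • rowBlock η := (rowBlockL β m).map_smul r η
        have e2 : rowBlock ((gammaTwo β : ℝ) • ζ) = (gammaTwo β : ℝ) • rowBlock ζ :=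
          (rowBlockL β m).map_smul _ ζ
        rw [e1, e2, hermMatrix_smul, ← hη, Matrix.mul_smul, Matrix.smul_mul]
        ext i j
        simp only [Matrix.smul_apply, smul_eq_mul, Complex.real_smul]
        push_cast
        have : (r : ℂ) ≠ 0 := by exact_mod_cast hr.ne'
        field_simp
      have hrow : rowForm ((gammaTwo β / r : ℝ) • z) (v + r • η) =
          gammaTwo β / r * rowForm z v + 2 * gammaTwo β * ∑ p, v p * ζ p +
            gammaTwo β * r * rowForm z η := by
        rw [rowForm_add hβ _ hηr, rowForm_smul, rowForm_smul]
        have e1 : rowBlock (r • η) = r • rowBlock η := (rowBlockL β m).map_smul r η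
        have e3 : rowForm z (r • η) = r ^ 2 * rowForm z η := by
          simp only [rowForm, e1, Matrix.conjTranspose_smul, Matrix.smul_mul, Matrix.mul_smul,
            Matrix.trace_smul]
          simp
          ring
        rw [e3]
        simp only [Pi.smul_apply, smul_eq_mul, Finset.mul_sum]
        congr 1
        · congr 1
          exact Finset.sum_congr rfl fun p _ => by ring
        · field_simp
      have hpt : ∀ t, ENNReal.ofReal (conePow e (border r v t) *
          Real.exp (-traceForm (border r v t) (border z₀ ζ z))) =
          (ENNReal.ofReal (r ^ e * Real.exp (-(gammaTwo β * s * r))) *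
          ENNReal.ofReal (Real.exp (-rowForm ((gammaTwo β / r : ℝ) • z) (v + r • η)))) *
          (fun t' => ENNReal.ofReal (conePow e t' * Real.exp (-traceForm t' z)))
            (t - r⁻¹ • q) := by
        intro t
        obtain ⟨hdt, hpd⟩ := det_border_and_posDef_border_iff hr.ne' v t q hq
        have hc : conePow e (border r v t) = r ^ e * conePow e (t - r⁻¹ • q) := by
          by_cases h : (hermMatrix β m (t - r⁻¹ • q)).PosDef
          · rw [conePow, conePow, if_pos ((hpd hr).2 h), if_pos h]
            have hd : hermDet (border r v t) = r ^ gammaTwo β * hermDet (t - r⁻¹ • q) := by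
              rw [← Complex.ofReal_inj, ← det_hermMatrix, hdt, det_hermMatrix]; push_cast; rfl
            rw [hd, Real.mul_rpow (by positivity) (hermDet_pos h).le, ← Real.rpow_natCast r,
              ← Real.rpow_mul hr.le]
            congr 2
            field_simp
          · rw [conePow, conePow, if_neg (mt (hpd hr).1 h), if_neg h, mul_zero]
        have ht : traceForm t z = traceForm (t - r⁻¹ • q) z + r⁻¹ * (gammaTwo β * rowForm z v) := by
          rw [sub_eq_add_neg, ← neg_smul, traceForm_add_left, traceForm_smul_left, hqz]; ring
        rw [← ENNReal.ofReal_mul (by positivity), ← ENNReal.ofReal_mul (by positivity), hc,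
          traceForm_border hβ, ht, hrow]
        congr 1
        have hexp : Real.exp (-(gammaTwo β * (r * z₀ + 2 * ∑ p, v p * ζ p) +
            (traceForm (t - r⁻¹ • q) z + r⁻¹ * (gammaTwo β * rowForm z v)))) =
            Real.exp (-(gammaTwo β * s * r)) *
              Real.exp (-(gammaTwo β / r * rowForm z v + 2 * gammaTwo β * ∑ p, v p * ζ p +
                gammaTwo β * r * rowForm z η)) * Real.exp (-traceForm (t - r⁻¹ • q) z) := by
          rw [← Real.exp_add, ← Real.exp_add]
          congr 1
          rw [hsdef]
          ring
        rw [hexp]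
        ring
      rw [lintegral_congr hpt]
      rw [lintegral_const_mul, lintegral_sub_right_eq_self
        (fun t' => ENNReal.ofReal (conePow e t' * Real.exp (-traceForm t' z))), hK, he', ih ha' hz']
      have hm1 : Measurable fun t' : HermCoord β m =>
          ENNReal.ofReal (conePow e t' * Real.exp (-traceForm t' z)) :=
        ((measurable_conePow e).mul (Real.measurable_exp.comp
          (continuous_traceForm _).measurable.neg)).ennreal_ofReal
      exact hm1.comp (measurable_id.sub_const _)
    -- the Gaussian integral over the first row, after completing the square
    have middle : ∀ r : ℝ, 0 < r → ∫⁻ v : Fin m × Fin β → ℝ,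
        ∫⁻ t, ENNReal.ofReal (conePow e (border r v t) *
          Real.exp (-traceForm (border r v t) (border z₀ ζ z))) =
        ENNReal.ofReal (r ^ (a - 1) * Real.exp (-(gammaTwo β * s * r))) *
          (ENNReal.ofReal ((Real.pi / gammaTwo β) ^ ((β : ℝ) * m / 2) *
            hermDet z ^ (-(β : ℝ) / (2 * gammaTwo β))) * K) := by
      intro r hr
      rw [lintegral_congr (inner r hr)]
      have hm1 : Measurable fun v : Fin m × Fin β → ℝ =>
          ENNReal.ofReal (Real.exp (-rowForm ((gammaTwo β / r : ℝ) • z) v)) :=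
        (Real.measurable_exp.comp (continuous_rowForm _).measurable.neg).ennreal_ofReal
      have hm2 : Measurable fun v : Fin m × Fin β → ℝ => ENNReal.ofReal
          (Real.exp (-rowForm ((gammaTwo β / r : ℝ) • z) (v + r • η))) :=
        hm1.comp (measurable_id.add_const (r • η))
      have hzr : (hermMatrix β m ((gammaTwo β / r : ℝ) • z)).PosDef := by
        rw [hermMatrix_smul]
        exact hz'.smul (by exact_mod_cast div_pos hg hr)
      rw [lintegral_mul_const _ (hm2.const_mul _), lintegral_const_mul _ hm2,
        lintegral_add_right_eq_self (fun v : Fin m × Fin β → ℝ =>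
          ENNReal.ofReal (Real.exp (-rowForm ((gammaTwo β / r : ℝ) • z) v))),
        lintegral_exp_neg_rowForm hβ hzr, ← mul_assoc]
      congr 1
      rw [← ENNReal.ofReal_mul (by positivity), ← ENNReal.ofReal_mul (by positivity)]
      congr 1
      have hdr : hermDet ((gammaTwo β / r : ℝ) • z) =
          (gammaTwo β / r : ℝ) ^ (m * gammaTwo β) * hermDet z := by
        rw [← Complex.ofReal_inj, ← det_hermMatrix, hermMatrix_smul, Matrix.det_smul,
          det_hermMatrix]
        simp
      rw [hdr, Real.mul_rpow (by positivity) hd0.le, ← Real.rpow_natCast (gammaTwo β / r : ℝ),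
        ← Real.rpow_mul (by positivity)]
      have e1 : ((m * gammaTwo β : ℕ) : ℝ) * (-(β : ℝ) / (2 * gammaTwo β)) =
          -((β : ℝ) * m / 2) := by
        push_cast; field_simp
      have e2 : a - 1 = e + (β : ℝ) * m / 2 := by rw [he]; push_cast; ring
      rw [e1, e2, Real.rpow_add hr, Real.rpow_neg (by positivity), Real.div_rpow hg.le hr.le,
        Real.div_rpow Real.pi_pos.le hg.le]
      have h1 : (gammaTwo β : ℝ) ^ ((β : ℝ) * m / 2) ≠ 0 := by positivity
      have h2 : r ^ ((β : ℝ) * m / 2) ≠ 0 := by positivity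
      field_simp
    -- the cone lies in `0 < r`, and there only a gamma integral is left
    have hzero : ∀ r : ℝ, r ∉ Set.Ioi (0 : ℝ) → ∫⁻ v : Fin m × Fin β → ℝ,
        ∫⁻ t, ENNReal.ofReal (conePow e (border r v t) *
          Real.exp (-traceForm (border r v t) (border z₀ ζ z))) = 0 := by
      intro r hr
      have : ∀ (v : Fin m × Fin β → ℝ) t, conePow e (border r v t) = 0 := fun v t =>
        if_neg fun h => hr (pos_of_posDef_border h).1
      simp [this]
    rw [← setLIntegral_eq_of_support_subset (s := Set.Ioi (0 : ℝ))
      (fun r hr => by_contra fun h => hr (hzero r h)),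
      setLIntegral_congr_fun measurableSet_Ioi (fun r hr => middle r hr),
      lintegral_mul_const _ (by fun_prop), lintegral_rpow_mul_exp ha0 (by positivity), hK,
      ← ENNReal.ofReal_mul (by positivity), ← ENNReal.ofReal_mul (by
        have := Real.Gamma_pos_of_pos ha0; positivity)]
    congr 1
    have e1 : -a / (gammaTwo β : ℝ) =
        -(β : ℝ) / (2 * gammaTwo β) + -(a - β / 2) / gammaTwo β := by field_simp; ring
    rw [hd, Real.mul_rpow (by positivity) hd0.le, ← Real.rpow_natCast s, ← Real.rpow_mul hs.le]
    have e2 : (gammaTwo β : ℝ) * (-a / gammaTwo β) = -a := by field_simp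
    rw [e2, e1, Real.rpow_add hd0, Real.mul_rpow hg.le hs.le, coneGamma]
    ring

/-! ### Analytic continuation to imaginary arguments -/

/-- The eigenvalues of `c + t S` for hermitian `S` and complex `c`, `t`, by diagonalization. -/
theorem charpoly_smul_one_add_smul {ι : Type*} [Fintype ι] [DecidableEq ι] {S : Matrix ι ι ℂ}
    (hS : S.IsHermitian) (c t : ℂ) :
    (c • 1 + t • S).charpoly =
      ∏ j, (Polynomial.X - Polynomial.C (c + t * (hS.eigenvalues j : ℂ))) := by
  have h : c • 1 + t • S = Unitary.conjStarAlgAut ℂ _ hS.eigenvectorUnitary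
      (diagonal fun j => c + t * (hS.eigenvalues j : ℂ)) := by
    have hd : (diagonal fun j => c + t * (hS.eigenvalues j : ℂ)) =
        c • (1 : Matrix ι ι ℂ) + t • diagonal (RCLike.ofReal ∘ hS.eigenvalues) := by
      ext i j
      by_cases hij : i = j
      · subst hij; simp
      · simp [hij]
    rw [hd, map_add, map_smul, map_smul, map_one, ← hS.spectral_theorem]
  rw [h, Unitary.conjStarAlgAut_apply, Matrix.charpoly_mul_comm, ← mul_assoc]
  simp [Matrix.charpoly_diagonal]

theorem roots_charpoly_smul_one_add_smul {ι : Type*} [Fintype ι] [DecidableEq ι]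
    {S : Matrix ι ι ℂ} (hS : S.IsHermitian) (c t : ℂ) :
    (c • 1 + t • S).charpoly.roots =
      Multiset.map (fun j => c + t * (hS.eigenvalues j : ℂ)) Finset.univ.val := by
  rw [charpoly_smul_one_add_smul hS, Polynomial.roots_prod]
  · simp only [Polynomial.roots_X_sub_C, Multiset.bind_singleton]
  · exact Finset.prod_ne_zero_iff.2 fun j _ => Polynomial.X_sub_C_ne_zero _

theorem det_smul_one_add_smul {ι : Type*} [Fintype ι] [DecidableEq ι] {S : Matrix ι ι ℂ}
    (hS : S.IsHermitian) (c t : ℂ) :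
    (c • 1 + t • S).det = ∏ j, (c + t * (hS.eigenvalues j : ℂ)) := by
  rw [Matrix.det_eq_prod_roots_charpoly, roots_charpoly_smul_one_add_smul hS]
  rfl

theorem posDef_smul_one_add_smul {ι : Type*} [Fintype ι] [DecidableEq ι] {S : Matrix ι ι ℂ}
    (hS : S.IsHermitian) {c t : ℝ} (h : ∀ j, 0 < c + t * hS.eigenvalues j) :
    ((c : ℂ) • 1 + (t : ℂ) • S).PosDef := by
  have hH : ((c : ℂ) • 1 + (t : ℂ) • S).IsHermitian := by
    refine (Matrix.isHermitian_one.smul (k := (c : ℂ)) ?_).add (hS.smul (k := (t : ℂ)) ?_) <;>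
      simp [IsSelfAdjoint]
  rw [hH.posDef_iff_eigenvalues_pos]
  intro i
  have hmem : (hH.eigenvalues i : ℂ) ∈ ((c : ℂ) • 1 + (t : ℂ) • S).charpoly.roots := by
    rw [hH.roots_charpoly_eq_eigenvalues]
    exact Multiset.mem_map.2 ⟨i, Finset.mem_univ_val i, rfl⟩
  rw [roots_charpoly_smul_one_add_smul hS] at hmem
  obtain ⟨j, -, hj⟩ := Multiset.mem_map.1 hmem
  have : c + t * hS.eigenvalues j = hH.eigenvalues i := by exact_mod_cast hj
  rw [← this]
  exact h j

/-- The parameters of the identity matrix. -/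
def hermOne (β m : ℕ) : HermCoord β m := Sum.elim (fun _ => 1) (fun _ => 0)

theorem hermMatrix_hermOne (β m : ℕ) : hermMatrix β m (hermOne β m) = 1 := by
  refine herm_ext (hermMatrix_isHermitian β m _) Matrix.isHermitian_one fun j k a b hjk => ?_
  rcases hjk.lt_or_eq with h | rfl
  · have h0 : numberBlock β (0 : Fin β → ℝ) = 0 := (numberBlockL β).map_zero
    refine (dif_pos h).trans ((congrFun (congrFun h0 a) b).trans ?_)
    rw [Matrix.one_apply_ne (by simp [h.ne])]
    rfl
  · rw [hermMatrix_diag]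
    simp [hermOne, Matrix.one_apply]

theorem hermMatrix_smul_one_add (β m : ℕ) (c t : ℝ) (s : HermCoord β m) :
    hermMatrix β m (c • hermOne β m + t • s) = (c : ℂ) • 1 + (t : ℂ) • hermMatrix β m s := by
  rw [hermMatrix_add, hermMatrix_smul, hermMatrix_smul, hermMatrix_hermOne]

theorem traceForm_smul_one_add {β m : ℕ} (c t : ℝ) (x s : HermCoord β m) :
    traceForm x (c • hermOne β m + t • s) =
      c * traceForm x (hermOne β m) + t * traceForm x s := by
  rw [traceForm_comm, traceForm_add_left, traceForm_smul_left, traceForm_smul_left,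
    traceForm_comm x, traceForm_comm x]

/-- The function `Δ^(a - 1 - β (m - 1) / 2) e^(-ε tr)` on the positive cone. -/
noncomputable def coneWeight {β m : ℕ} (a ε : ℝ) (x : HermCoord β m) : ℝ :=
  conePow (a - 1 - β * ((m : ℝ) - 1) / 2) x * Real.exp (-(ε * traceForm x (hermOne β m)))

theorem coneWeight_nonneg {β m : ℕ} (a ε : ℝ) (x : HermCoord β m) : 0 ≤ coneWeight a ε x :=
  mul_nonneg (conePow_nonneg _ _) (Real.exp_pos _).le

theorem measurable_coneWeight {β m : ℕ} (a ε : ℝ) :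
    Measurable (coneWeight a ε : HermCoord β m → ℝ) :=
  (measurable_conePow _).mul (Real.measurable_exp.comp
    ((continuous_traceForm _).measurable.const_mul ε).neg)

theorem coneGamma_pos {β : ℕ} {m : ℕ} {a : ℝ} (ha : ∀ k < m, (β : ℝ) * k / 2 < a) :
    0 < coneGamma β m a := by
  have hg : (0 : ℝ) < gammaTwo β := by exact_mod_cast gammaTwo_pos β
  induction m generalizing a with
  | zero => simp [coneGamma]
  | succ m ih =>
    have ha0 : 0 < a := by simpa using ha 0 (Nat.succ_pos m)
    have h1 := ih (a := a - β / 2) fun k hk => by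
      have := ha (k + 1) (Nat.succ_lt_succ hk)
      push_cast at this
      linarith
    have h2 := Real.Gamma_pos_of_pos ha0
    rw [coneGamma]
    positivity

/-- The Laplace transform along the line `ε + t S`, as long as it stays in the cone, in terms of the
eigenvalues of `S`. -/
theorem lintegral_coneWeight_mul_exp {β : ℕ} (hβ : β = 1 ∨ β = 2 ∨ β = 4) {m : ℕ} {a ε : ℝ}
    (ha : ∀ k < m, (β : ℝ) * k / 2 < a) (s : HermCoord β m) {t : ℝ}
    (h : ∀ j, 0 < ε + t * (hermMatrix_isHermitian β m s).eigenvalues j) :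
    ∫⁻ x, ENNReal.ofReal (coneWeight a ε x * Real.exp (t * -traceForm x s)) =
      ENNReal.ofReal (coneGamma β m a *
        ∏ j, (ε + t * (hermMatrix_isHermitian β m s).eigenvalues j) ^ (-a / gammaTwo β)) := by
  have hpd := posDef_smul_one_add_smul (hermMatrix_isHermitian β m s) h
  rw [← hermMatrix_smul_one_add] at hpd
  have hL := lintegral_conePow_mul_exp hβ ha hpd
  have hdet : hermDet (ε • hermOne β m + t • s) =
      ∏ j, (ε + t * (hermMatrix_isHermitian β m s).eigenvalues j) := by
    rw [← Complex.ofReal_inj, ← det_hermMatrix, hermMatrix_smul_one_add,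
      det_smul_one_add_smul (hermMatrix_isHermitian β m s)]
    push_cast; rfl
  rw [hdet, ← Real.finsetProd_rpow _ _ (fun j _ => (h j).le)] at hL
  rw [← hL]
  refine lintegral_congr fun x => ?_
  rw [coneWeight, mul_assoc, ← Real.exp_add, traceForm_smul_one_add]
  congr 3
  ring

theorem integrable_coneWeight_mul_exp {β : ℕ} (hβ : β = 1 ∨ β = 2 ∨ β = 4) {m : ℕ} {a ε : ℝ}
    (ha : ∀ k < m, (β : ℝ) * k / 2 < a) (s : HermCoord β m) {t : ℝ}
    (h : ∀ j, 0 < ε + t * (hermMatrix_isHermitian β m s).eigenvalues j) :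
    Integrable fun x => coneWeight a ε x * Real.exp (t * -traceForm x s) := by
  refine ⟨((measurable_coneWeight a ε).mul (Real.measurable_exp.comp
    ((continuous_traceForm s).measurable.neg.const_mul t))).aestronglyMeasurable, ?_⟩
  rw [hasFiniteIntegral_iff_ofReal (ae_of_all _ fun x =>
    mul_nonneg (coneWeight_nonneg a ε x) (Real.exp_pos _).le),
    lintegral_coneWeight_mul_exp hβ ha s h]
  exact ENNReal.ofReal_lt_top

theorem integrable_coneWeight {β : ℕ} (hβ : β = 1 ∨ β = 2 ∨ β = 4) {m : ℕ} {a ε : ℝ}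
    (ha : ∀ k < m, (β : ℝ) * k / 2 < a) (hε : 0 < ε) :
    Integrable (coneWeight a ε : HermCoord β m → ℝ) := by
  simpa using integrable_coneWeight_mul_exp (t := 0) hβ ha (0 : HermCoord β m)
    fun j => by simpa using hε

/-- The Fourier transform of `coneWeight`, by analytic continuation of the Laplace transform. -/
theorem integral_coneWeight_mul_cexp {β : ℕ} (hβ : β = 1 ∨ β = 2 ∨ β = 4) {m : ℕ} {a ε : ℝ}
    (ha : ∀ k < m, (β : ℝ) * k / 2 < a) (hε : 0 < ε) (s : HermCoord β m) :
    ∫ x, (coneWeight a ε x : ℂ) * Complex.exp (Complex.I * traceForm x s) =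
      coneGamma β m a * ∏ j, ((ε : ℂ) - Complex.I * (hermMatrix_isHermitian β m s).eigenvalues j) ^
        ((-a / gammaTwo β : ℝ) : ℂ) := by
  set ev := (hermMatrix_isHermitian β m s).eigenvalues with hev
  -- the integral is the moment generating function of `X` under `μ`, at the argument `-i`
  let μ : Measure (HermCoord β m) := volume.withDensity fun x => ENNReal.ofReal (coneWeight a ε x)
  let X : HermCoord β m → ℝ := fun x => -traceForm x s
  let D : Set ℝ := {t | ∀ j, 0 < ε + t * ev j}
  have hDopen : IsOpen D := by
    have : D = ⋂ j, {t | 0 < ε + t * ev j} := by ext t; simp [D]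
    rw [this]
    exact isOpen_iInter_of_finite fun j => isOpen_lt continuous_const (by fun_prop)
  have hDconv : Convex ℝ D := by
    intro x hx y hy p q hp hq hpq j
    have h1 := hx j
    have h2 := hy j
    have : ε + (p • x + q • y) * ev j = p * (ε + x * ev j) + q * (ε + y * ev j) := by
      simp only [smul_eq_mul]; linear_combination ε * (-hpq)
    rw [this]
    rcases hp.eq_or_lt with rfl | hp
    · have : q = 1 := by linarith
      simp [this, h2]
    · have := mul_pos hp h1
      have := mul_nonneg hq h2.le
      linarith
  have hD0 : (0 : ℝ) ∈ D := fun j => by simpa using hε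
  have hsm : ∀ {F : HermCoord β m → ℂ}, ∫ x, F x ∂μ = ∫ x, (coneWeight a ε x : ℂ) * F x := by
    intro F
    have h := integral_withDensity_eq_integral_smul (μ := volume)
      (f := fun x : HermCoord β m => Real.toNNReal (coneWeight a ε x))
      (measurable_coneWeight a ε).real_toNNReal F
    refine h.trans (integral_congr_ae (ae_of_all _ fun x => ?_))
    simp only [NNReal.smul_def, Real.coe_toNNReal _ (coneWeight_nonneg a ε x), Complex.real_smul]
  have hsub : D ⊆ interior (integrableExpSet X μ) := by
    refine interior_maximal (fun t ht => ?_) hDopen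
    have h := integrable_coneWeight_mul_exp hβ ha s (ε := ε) (t := t) ht
    change Integrable (fun x => Real.exp (t * X x)) μ
    refine (integrable_withDensity_iff_integrable_smul (μ := volume)
      (f := fun x : HermCoord β m => Real.toNNReal (coneWeight a ε x))
      (measurable_coneWeight a ε).real_toNNReal).2 ?_
    refine h.congr (ae_of_all _ fun x => ?_)
    simp only [NNReal.smul_def, Real.coe_toNNReal _ (coneWeight_nonneg a ε x), smul_eq_mul, X]
  -- both sides are analytic on the strip over `D`, where `ε + z s_j` avoids the branch cut
  let g : ℂ → ℂ := fun z => coneGamma β m a * ∏ j, ((ε : ℂ) + z * ev j) ^ ((-a / gammaTwo β : ℝ) : ℂ)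
  let U : Set ℂ := {z | z.re ∈ D}
  have hU : IsOpen U := hDopen.preimage Complex.continuous_re
  have hg : AnalyticOnNhd ℂ g U := by
    refine DifferentiableOn.analyticOnNhd (fun z hz => ?_) hU
    refine DifferentiableAt.differentiableWithinAt ?_
    refine DifferentiableAt.const_mul ?_ _
    refine DifferentiableAt.fun_finsetProd fun j _ => ?_
    refine DifferentiableAt.cpow_const (by fun_prop) (Or.inl ?_)
    simpa using hz j
  have hf : AnalyticOnNhd ℂ (complexMGF X μ) U := fun z hz => analyticAt_complexMGF (hsub hz)
  have hreal : ∀ t ∈ D, complexMGF X μ (t : ℂ) = g t := by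
    intro t ht
    have hl := lintegral_coneWeight_mul_exp hβ ha s (ε := ε) (t := t) ht
    have hi := integrable_coneWeight_mul_exp hβ ha s (ε := ε) (t := t) ht
    rw [← ofReal_integral_eq_lintegral_ofReal hi (ae_of_all _ fun x =>
      mul_nonneg (coneWeight_nonneg a ε x) (Real.exp_pos _).le), ENNReal.ofReal_eq_ofReal_iff
        (integral_nonneg fun x => mul_nonneg (coneWeight_nonneg a ε x) (Real.exp_pos _).le)
        (mul_nonneg (coneGamma_pos ha).le (Finset.prod_nonneg fun j _ =>
          Real.rpow_nonneg (ht j).le _))] at hl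
    have hl' := congrArg (fun r : ℝ => (r : ℂ)) hl
    simp only [← integral_complex_ofReal] at hl'
    rw [complexMGF, hsm]
    refine Eq.trans ?_ (hl'.trans ?_)
    · refine integral_congr_ae (ae_of_all _ fun x => ?_)
      simp only [X]
      push_cast; rfl
    · simp only [g]
      push_cast
      congr 1
      refine Finset.prod_congr rfl fun j _ => ?_
      have := ht j
      rw [Complex.ofReal_cpow (this.le)]
      push_cast; rfl
  have hEq : Set.EqOn (complexMGF X μ) g U := by
    refine AnalyticOnNhd.eqOn_of_preconnected_of_frequently_eq hf hg
      (hDconv.linear_preimage Complex.reLm).isPreconnected (z₀ := ((0 : ℝ) : ℂ))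
      (by simpa [U] using hD0) ?_
    have h_real : ∃ᶠ (x : ℝ) in nhdsWithin 0 {0}ᶜ, complexMGF X μ x = g x := by
      refine Filter.Eventually.frequently ?_
      filter_upwards [nhdsWithin_le_nhds (hDopen.mem_nhds hD0)] with x hx
      exact hreal x hx
    rw [Filter.frequently_iff_seq_forall] at h_real ⊢
    obtain ⟨xs, hx_tendsto, hx_eq⟩ := h_real
    refine ⟨fun n => xs n, ?_, fun n => ?_⟩
    · rw [tendsto_nhdsWithin_iff] at hx_tendsto ⊢
      constructor
      · rw [Filter.tendsto_ofReal_iff]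
        exact hx_tendsto.1
      · simpa using hx_tendsto.2
    · simp [hx_eq]
  have hI := hEq (show -Complex.I ∈ U by simpa [U] using hD0)
  rw [complexMGF, hsm] at hI
  refine Eq.trans ?_ (hI.trans ?_)
  · refine integral_congr_ae (ae_of_all _ fun x => ?_)
    simp only [X]
    push_cast
    congr 2
    ring
  · simp only [g]
    congr 1
    refine Finset.prod_congr rfl fun j _ => ?_
    congr 1
    ring

/-- No branch cut is crossed when a number of the right half plane is turned by a right angle. -/
theorem mul_I_cpow_real {z : ℂ} (hz : 0 < z.re) (p : ℝ) :
    (Complex.I * z) ^ (p : ℂ) = Complex.I ^ (p : ℂ) * z ^ (p : ℂ) := by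
  have harg := abs_lt.1 (Complex.abs_arg_lt_pi_div_two_iff.2 (Or.inl hz))
  have hpi := Real.pi_pos
  have hz0 : z ≠ 0 := by rintro rfl; simp at hz
  rw [Complex.cpow_def_of_ne_zero (mul_ne_zero Complex.I_ne_zero hz0),
    Complex.cpow_def_of_ne_zero Complex.I_ne_zero, Complex.cpow_def_of_ne_zero hz0,
    (Complex.log_mul_eq_add_log_iff Complex.I_ne_zero hz0).2 ?_, add_mul, Complex.exp_add]
  rw [Complex.arg_I]
  constructor <;> linarith [harg.1, harg.2]

/-- The eigenvalues of `S + iε` are `s_j + iε = i (ε - i s_j)`; there are `γ₂ m` of them, and each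
contributes the phase `i^(-a / γ₂)`. -/
theorem detPow_shiftPlus {β : ℕ} {m : ℕ} {a ε : ℝ} (hε : 0 < ε) (s : HermCoord β m) :
    detPow (shiftPlus ε (hermMatrix β m s)) ((-a / gammaTwo β : ℝ) : ℂ) =
      Complex.I ^ ((-(a * m) : ℝ) : ℂ) *
        ∏ j, ((ε : ℂ) - Complex.I * (hermMatrix_isHermitian β m s).eigenvalues j) ^
          ((-a / gammaTwo β : ℝ) : ℂ) := by
  have hg : (gammaTwo β : ℝ) ≠ 0 := by exact_mod_cast (gammaTwo_pos β).ne'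
  have h1 : shiftPlus ε (hermMatrix β m s) =
      (Complex.I * (ε : ℂ)) • 1 + (1 : ℂ) • hermMatrix β m s := by
    rw [shiftPlus, one_smul, add_comm]
  rw [detPow, h1, roots_charpoly_smul_one_add_smul (hermMatrix_isHermitian β m s), Multiset.map_map]
  change ∏ j, (Complex.I * (ε : ℂ) + 1 * ((hermMatrix_isHermitian β m s).eigenvalues j : ℂ)) ^
    ((-a / gammaTwo β : ℝ) : ℂ) = _
  have h2 : ∀ j, (Complex.I * (ε : ℂ) + 1 * ((hermMatrix_isHermitian β m s).eigenvalues j : ℂ)) ^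
      ((-a / gammaTwo β : ℝ) : ℂ) = Complex.I ^ ((-a / gammaTwo β : ℝ) : ℂ) *
      ((ε : ℂ) - Complex.I * (hermMatrix_isHermitian β m s).eigenvalues j) ^
          ((-a / gammaTwo β : ℝ) : ℂ) := by
    intro j
    rw [← mul_I_cpow_real (by simpa using hε)]
    congr 1
    linear_combination ((hermMatrix_isHermitian β m s).eigenvalues j : ℂ) * Complex.I_sq
  rw [Finset.prod_congr rfl fun j _ => h2 j, Finset.prod_mul_distrib]
  congr 1
  rw [Finset.prod_const, ← Complex.cpow_nat_mul]
  congr 1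
  simp only [Finset.card_univ, Fintype.card_prod, Fintype.card_fin]
  rw [← Complex.ofReal_natCast, ← Complex.ofReal_mul]
  congr 1
  push_cast
  field_simp

/-! ### Fourier transforms on Euclidean spaces -/

section Fourier

variable {V : Type*} [NormedAddCommGroup V] [InnerProductSpace ℝ V] [FiniteDimensional ℝ V]
  [MeasurableSpace V] [BorelSpace V] {f : V → ℂ}

theorem norm_fourier_le_integral_norm (w : V) : ‖𝓕 f w‖ ≤ ∫ v, ‖f v‖ :=
  VectorFourier.norm_fourierIntegral_le_integral_norm _ _ _ _ _

theorem continuous_fourier_of_integrable (hf : Integrable f) : Continuous (𝓕 f) :=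
  VectorFourier.fourierIntegral_continuous Real.continuous_fourierChar
    (by exact continuous_inner) hf

theorem integrable_gaussian_mul_fourier (hf : Integrable f) {δ : ℝ} (hδ : 0 < δ) (v : V) :
    Integrable fun w => Complex.exp (-δ * ‖w‖ ^ 2 + 2 * Real.pi * Complex.I * ⟪v, w⟫) * 𝓕 f w :=
  (GaussianFourier.integrable_cexp_neg_mul_sq_norm_add (b := δ) (by simpa)
    (2 * Real.pi * Complex.I) v).mul_bdd (c := ∫ v, ‖f v‖)
    (continuous_fourier_of_integrable hf).aestronglyMeasurable
    (ae_of_all _ norm_fourier_le_integral_norm)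

/-- Gaussian summation of the inverse Fourier integral recovers `f` at its continuity points. -/
theorem tendsto_integral_gaussian_mul_fourier (hf : Integrable f) {v : V} (hv : ContinuousAt f v) :
    Filter.Tendsto (fun δ : ℝ =>
      ∫ w, Complex.exp (-δ * ‖w‖ ^ 2 + 2 * Real.pi * Complex.I * ⟪v, w⟫) * 𝓕 f w)
      (nhdsWithin 0 (Set.Ioi 0)) (nhds (f v)) := by
  refine ((Real.tendsto_integral_gaussian_smul' hf hv).comp tendsto_inv_nhdsGT_zero).congr' ?_
  filter_upwards [self_mem_nhdsWithin] with δ hδ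
  have hδ : 0 < δ := hδ
  have hδ' : 0 < δ⁻¹ := inv_pos.2 hδ
  have J : Integrable (fun w : V => Complex.exp (-δ * ‖w‖ ^ 2 + 2 * Real.pi * Complex.I * ⟪v, w⟫)) :=
    GaussianFourier.integrable_cexp_neg_mul_sq_norm_add (by simpa) _ _
  have h := (VectorFourier.integral_fourierIntegral_smul_eq_flip (L := innerₗ V)
      Real.continuous_fourierChar continuous_inner J hf)
  have h' : ∫ w : V, 𝓕 (fun w : V => Complex.exp (-δ * ‖w‖ ^ 2 + 2 * Real.pi * Complex.I * ⟪v, w⟫)) w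
      • f w = ∫ w, Complex.exp (-δ * ‖w‖ ^ 2 + 2 * Real.pi * Complex.I * ⟪v, w⟫) • 𝓕 f w := by
    simpa using! h
  simp only [smul_eq_mul] at h'
  rw [← h']
  refine integral_congr_ae (ae_of_all _ fun w => ?_)
  beta_reduce
  rw [fourier_gaussian_innerProductSpace' (by simpa), smul_eq_mul]
  congr 2
  · congr 1
    push_cast
    rw [div_eq_mul_inv]
  · congr 1
    push_cast
    field_simp

/-- The Fourier transform is symmetric for the bilinear pairing of `L¹` and Schwartz functions. -/
theorem integral_fourier_schwartz_mul (hf : Integrable f) (χ : 𝓢(V, ℂ)) :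
    ∫ w, 𝓕 χ w * f w = ∫ w, χ w * 𝓕 f w := by
  have h := VectorFourier.integral_fourierIntegral_smul_eq_flip (L := innerₗ V)
    Real.continuous_fourierChar continuous_inner (χ.integrable (μ := volume)) hf
  simpa using! h

/-- Plancherel for Fourier integrals: if an integrable function is square integrable, its Fourier
integral agrees with its `L²` Fourier transform. -/
theorem memLp_fourier (hf : Integrable f) (hf2 : MemLp f 2) : MemLp (𝓕 f) 2 := by
  set F : Lp ℂ 2 (volume : Measure V) := hf2.toLp f with hF
  have hFf : F =ᵐ[volume] f := hf2.coeFn_toLp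
  set G : Lp ℂ 2 (volume : Measure V) := 𝓕 F with hG
  have hGm : MemLp G 2 := Lp.memLp G
  have hdist := Lp.fourier_toTemperedDistribution_eq F
  have hloc : LocallyIntegrable (fun x => G x - 𝓕 f x) :=
    (hGm.locallyIntegrable (by norm_num)).sub
      (continuous_fourier_of_integrable hf).locallyIntegrable
  -- both transforms agree as tempered distributions, hence almost everywhere
  have hae := ae_eq_zero_of_integral_contDiff_smul_eq_zero hloc fun g hg hgs => by
    have hgs' : HasCompactSupport fun x => (g x : ℂ) := hgs.comp_left Complex.ofReal_zero
    let φ : 𝓢(V, ℂ) := hgs'.toSchwartzMap (Complex.ofRealCLM.contDiff.comp hg)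
    have hφ : ∀ x, φ x = (g x : ℂ) := fun x => rfl
    have h1 := congrArg (fun T => T φ) hdist
    simp only [TemperedDistribution.fourier_apply, Lp.toTemperedDistribution_apply] at h1
    have h2 : ∫ x, 𝓕 φ x • F x = ∫ x, φ x • 𝓕 f x := by
      have h3 : ∫ x, 𝓕 φ x • F x = ∫ x, 𝓕 φ x • f x :=
        integral_congr_ae (hFf.mono fun x hx => by simp only [hx])
      rw [h3]
      simpa only [smul_eq_mul] using integral_fourier_schwartz_mul hf φ
    have hi1 : Integrable fun x => φ x • G x := by
      have := MemLp.integrable_mul (φ.memLp 2) hGm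
      exact this
    have hi2 : Integrable fun x => φ x • 𝓕 f x :=
      φ.integrable.mul_bdd (c := ∫ v, ‖f v‖)
        (continuous_fourier_of_integrable hf).aestronglyMeasurable
        (ae_of_all _ norm_fourier_le_integral_norm)
    have h5 : ∀ x, g x • (G x - 𝓕 f x) = φ x • G x - φ x • 𝓕 f x := fun x => by
      rw [hφ, ← smul_sub, smul_eq_mul, Complex.real_smul]
    simp_rw [h5]
    rw [integral_sub hi1 hi2, ← h2, h1, sub_self]
  refine hGm.ae_eq (hae.mono fun x hx => ?_)
  exact sub_eq_zero.1 hx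

/-- Parseval's formula for an integrable and a Schwartz function. -/
theorem integral_fourier_mul_fourier_neg (hf : Integrable f) (ψ : 𝓢(V, ℂ)) :
    ∫ w, 𝓕 ψ w * 𝓕 f (-w) = ∫ x, ψ x * f x := by
  rw [← integral_neg_eq_self]
  simp only [neg_neg]
  have h1 : ∀ w, 𝓕 ψ (-w) = (𝓕⁻ ψ : 𝓢(V, ℂ)) w := fun w => by
    rw [SchwartzMap.fourierInv_coe, Real.fourierInv_eq_fourier_neg]; rfl
  simp_rw [h1]
  rw [← integral_fourier_schwartz_mul hf, FourierTransform.fourier_fourierInv_eq]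

/-- Stated for an abstract `V`, where `IsNegInvariant` is found by instance search; on
`EuclideanSpace ℝ ι` it is not. -/
theorem integral_comp_neg (g : V → ℂ) : ∫ w, g (-w) = ∫ w, g w :=
  integral_neg_eq_self g volume

theorem integrable_comp_neg {g : V → ℂ} (hg : Integrable g) : Integrable fun w => g (-w) :=
  hg.comp_neg

theorem integrable_schwartz_mul (hf : Integrable f) (χ : 𝓢(V, ℂ)) :
    Integrable fun w => χ w * f w :=
  hf.bdd_mul (c := SchwartzMap.seminorm ℝ 0 0 χ) χ.continuous.aestronglyMeasurable
    (ae_of_all _ fun w => χ.norm_le_seminorm ℝ w)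

theorem integrable_schwartz_mul_fourier_neg (hf : Integrable f) (χ : 𝓢(V, ℂ)) :
    Integrable fun w => χ w * 𝓕 f (-w) :=
  χ.integrable.mul_bdd (c := ∫ v, ‖f v‖)
    ((continuous_fourier_of_integrable hf).comp continuous_neg).aestronglyMeasurable
    (ae_of_all _ fun _ => norm_fourier_le_integral_norm _)

end Fourier

/-! ### Euclidean coordinates for the trace form -/

/-- The weight of a parameter in the form `tr (X Y) / (2 π)`. -/
noncomputable def traceWeight {β m : ℕ} (i : HermIdx β m) : ℝ :=
  gammaTwo β * Sum.elim (fun _ => 1) (fun _ => 2) i / (2 * Real.pi)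

theorem traceWeight_pos {β m : ℕ} (i : HermIdx β m) : 0 < traceWeight i := by
  have hg : (0 : ℝ) < gammaTwo β := by exact_mod_cast gammaTwo_pos β
  have hpi := Real.pi_pos
  rcases i with j | q <;> simp only [traceWeight, Sum.elim_inl, Sum.elim_inr] <;> positivity

/-- Coordinates in which `tr (X Y) / (2 π)` is the standard inner product. -/
noncomputable def hermEuclid (β m : ℕ) : HermCoord β m ≃L[ℝ] EuclideanSpace ℝ (HermIdx β m) :=
  ((LinearEquiv.piCongrRight fun i => LinearEquiv.smulOfNeZero ℝ ℝ (Real.sqrt (traceWeight i))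
    (Real.sqrt_pos.2 (traceWeight_pos i)).ne').trans
      (WithLp.linearEquiv 2 ℝ (HermIdx β m → ℝ)).symm).toContinuousLinearEquiv

theorem hermEuclid_apply {β m : ℕ} (x : HermCoord β m) (i : HermIdx β m) :
    hermEuclid β m x i = Real.sqrt (traceWeight i) * x i := rfl

/-- The factor `2 π` of the Mathlib Fourier transform is absorbed into the coordinates, so that the
phases `exp (± i tr (X Y))` become characters of the Euclidean space. -/
theorem inner_hermEuclid {β m : ℕ} (hβ : β = 1 ∨ β = 2 ∨ β = 4) (x y : HermCoord β m) :
    2 * Real.pi * ⟪hermEuclid β m x, hermEuclid β m y⟫ = traceForm x y := by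
  rw [traceForm, trace_hermMatrix_mul hβ, Complex.ofReal_re, PiLp.inner_apply, Finset.mul_sum]
  refine Finset.sum_congr rfl fun i _ => ?_
  rw [hermEuclid_apply, hermEuclid_apply]
  have h := Real.mul_self_sqrt (traceWeight_pos i).le
  have hpi := Real.pi_ne_zero
  simp only [RCLike.inner_apply, conj_trivial]
  have h2 : 2 * Real.pi * traceWeight i = gammaTwo β * Sum.elim (fun _ => 1) (fun _ => 2) i := by
    rw [traceWeight]; field_simp
  rw [← h2]
  linear_combination (2 * Real.pi * x i * y i) * h

/-- The Jacobian of the inverse of `hermEuclid`. -/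
noncomputable def hermJacobian (β m : ℕ) : ℝ := ∏ i : HermIdx β m, (Real.sqrt (traceWeight i))⁻¹

theorem hermJacobian_pos (β m : ℕ) : 0 < hermJacobian β m :=
  Finset.prod_pos fun i _ => inv_pos.2 (Real.sqrt_pos.2 (traceWeight_pos i))

theorem map_hermEuclid (β m : ℕ) :
    Measure.map (hermEuclid β m) volume = ENNReal.ofReal (hermJacobian β m) • volume := by
  set D : HermIdx β m → ℝ := fun i => Real.sqrt (traceWeight i) with hD
  have hDpos : 0 < ∏ i, D i := Finset.prod_pos fun i _ => Real.sqrt_pos.2 (traceWeight_pos i)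
  have hdet : (Matrix.diagonal D).det ≠ 0 := by rw [Matrix.det_diagonal]; exact hDpos.ne'
  have h1 := Real.map_matrix_volume_pi_eq_smul_volume_pi hdet
  have h2 := (EuclideanSpace.volume_preserving_symm_measurableEquiv_toLp (HermIdx β m)).symm
  have hcomp : (hermEuclid β m : HermCoord β m → EuclideanSpace ℝ (HermIdx β m)) =
      (MeasurableEquiv.toLp 2 (HermIdx β m → ℝ)) ∘ (Matrix.toLin' (Matrix.diagonal D)) := by
    funext x
    ext i
    rw [hermEuclid_apply]
    simp [Matrix.mulVec_diagonal, D]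
  have hmeas : Measurable (Matrix.toLin' (Matrix.diagonal D)) :=
    (LinearMap.continuous_of_finiteDimensional _).measurable
  rw [hcomp, ← Measure.map_map (MeasurableEquiv.measurable _) hmeas, h1, Measure.map_smul]
  congr 1
  · rw [Matrix.det_diagonal, hermJacobian, Finset.prod_inv_distrib, abs_of_pos (inv_pos.2 hDpos)]
  · exact h2.map_eq

theorem integral_comp_hermEuclid {β m : ℕ} (g : EuclideanSpace ℝ (HermIdx β m) → ℂ) :
    ∫ s, g (hermEuclid β m s) = hermJacobian β m * ∫ y, g y := by
  have h := (hermEuclid β m).toHomeomorph.measurableEmbedding.integral_map (μ := volume) g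
  have h' : ∫ y, g y ∂(Measure.map (hermEuclid β m) volume) = ∫ s, g (hermEuclid β m s) := h
  rw [← h', map_hermEuclid, integral_smul_measure, ENNReal.toReal_ofReal (hermJacobian_pos β m).le,
    Complex.real_smul]

theorem integrable_comp_hermEuclid {β m : ℕ} {g : EuclideanSpace ℝ (HermIdx β m) → ℂ} :
    (Integrable fun s => g (hermEuclid β m s)) ↔ Integrable g := by
  have h' : Integrable g (Measure.map (hermEuclid β m) volume) ↔
      Integrable (fun s => g (hermEuclid β m s)) :=
    MeasurableEmbedding.integrable_map_iff (hermEuclid β m).toHomeomorph.measurableEmbedding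
  rw [← h', map_hermEuclid]
  exact integrable_smul_measure (by simpa using hermJacobian_pos β m) ENNReal.ofReal_ne_top

theorem sq_hermJacobian (β m : ℕ) :
    hermJacobian β m ^ 2 = ∏ i : HermIdx β m, (traceWeight i)⁻¹ := by
  rw [hermJacobian, ← Finset.prod_pow]
  refine Finset.prod_congr rfl fun i _ => ?_
  rw [inv_pow, Real.sq_sqrt (traceWeight_pos i).le]

theorem sq_hermJacobian_succ (β m : ℕ) :
    hermJacobian β (m + 1) ^ 2 = 2 * Real.pi / gammaTwo β *
      (Real.pi / gammaTwo β) ^ (m * β) * hermJacobian β m ^ 2 := by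
  have hw : ∀ s, (traceWeight (hermIdxSplit β m s))⁻¹ =
      Sum.elim (Sum.elim (fun _ => 2 * Real.pi / gammaTwo β) (fun _ => Real.pi / gammaTwo β))
        (fun i => (traceWeight i)⁻¹) s := by
    have hpi := Real.pi_ne_zero
    have hg : (gammaTwo β : ℝ) ≠ 0 := by exact_mod_cast (gammaTwo_pos β).ne'
    rintro ((_ | p) | i) <;> simp only [traceWeight, weight_hermIdxSplit, Sum.elim_inl, Sum.elim_inr]
    · field_simp
    · field_simp
  rw [sq_hermJacobian, sq_hermJacobian, ← (hermIdxSplit β m).prod_comp]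
  simp only [hw, Fintype.prod_sum_type, Sum.elim_inl, Sum.elim_inr, Finset.prod_const,
    Finset.card_univ, Fintype.card_unit, Fintype.card_prod, Fintype.card_fin, pow_one]

/-- The constant `G` is the Jacobian of the Fourier inversion over the Gindikin gamma factor. -/
theorem sq_hermJacobian_div_coneGamma {β m : ℕ} (n : ℝ)
    (ha : ∀ k < m, (β : ℝ) * k / 2 < β * n / 2) :
    hermJacobian β m ^ 2 / coneGamma β m (β * n / 2) = inghamConstant β m n := by
  have hg : (0 : ℝ) < gammaTwo β := by exact_mod_cast gammaTwo_pos β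
  have hpi := Real.pi_pos
  induction m generalizing n with
  | zero => simp [sq_hermJacobian, coneGamma, inghamConstant]
  | succ m ih =>
    have ha0 : 0 < (β : ℝ) * n / 2 := by simpa using ha 0 (Nat.succ_pos m)
    have ha' : ∀ k < m, (β : ℝ) * k / 2 < β * (n - 1) / 2 := fun k hk => by
      have := ha (k + 1) (Nat.succ_lt_succ hk)
      push_cast at this
      linarith
    have h := ih (n - 1) ha'
    have hG := Real.Gamma_pos_of_pos ha0
    have hc := coneGamma_pos ha'
    rw [sq_hermJacobian_succ, coneGamma, show (β : ℝ) * n / 2 - β / 2 = β * (n - 1) / 2 by ring]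
    have hstep : inghamConstant β (m + 1) n = inghamConstant β m (n - 1) *
        ((gammaTwo β / Real.pi) ^ ((β : ℝ) * (n - m) / 2 - 1) *
          (2 * Real.pi ^ ((β : ℝ) * n / 2) / Real.Gamma ((β : ℝ) * n / 2))) := by
      rw [inghamConstant, inghamConstant, Finset.prod_range_succ]
      have e1 : n - ((m + 1 : ℕ) : ℝ) + 1 = n - m := by push_cast; ring
      have e2 : n - 1 - (m : ℝ) + 1 = n - m := by ring
      have e3 : n - (m : ℝ) + m = n := by ring
      rw [e1, e2, e3]
      have e4 : (β : ℝ) * ((m + 1 : ℕ) : ℝ) * (n - m) / 2 - ((m + 1 : ℕ) : ℝ) =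
          (β * m * (n - m) / 2 - m) + (β * (n - m) / 2 - 1) := by push_cast; ring
      rw [e4, Real.rpow_add (by positivity)]
      ring
    rw [hstep, ← h]
    have e5 : (gammaTwo β / Real.pi : ℝ) ^ ((β : ℝ) * (n - m) / 2 - 1) =
        Real.pi / gammaTwo β * (Real.pi / gammaTwo β) ^ ((β : ℝ) * m / 2) *
          ((gammaTwo β : ℝ) ^ ((β : ℝ) * n / 2) * (Real.pi ^ ((β : ℝ) * n / 2))⁻¹) := by
      have : (β : ℝ) * (n - m) / 2 - 1 = β * n / 2 + -(β * m / 2) + -1 := by ring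
      rw [this, Real.rpow_add (by positivity), Real.rpow_add (by positivity),
        Real.div_rpow hg.le hpi.le, Real.rpow_neg (by positivity), Real.rpow_neg_one,
        ← Real.inv_rpow (by positivity), inv_div]
      ring
    have e6 : (Real.pi / gammaTwo β : ℝ) ^ (m * β) =
        (Real.pi / gammaTwo β) ^ ((β : ℝ) * m / 2) * (Real.pi / gammaTwo β) ^ ((β : ℝ) * m / 2) := by
      rw [← Real.rpow_natCast, ← Real.rpow_add (by positivity)]
      congr 1
      push_cast; ring
    rw [e5, e6, Real.rpow_neg hg.le]
    field_simp

/-! ### The determinantal power as a Fourier transform -/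

/-- `conePow` is continuous except, for exponent zero, on the boundary of the cone. -/
theorem continuousAt_conePow {β m : ℕ} {e : ℝ} (x : HermCoord β m)
    (h : 0 < e ∨ (hermMatrix β m x).PosDef ∨ ¬ (hermMatrix β m x).PosSemidef) :
    ContinuousAt (conePow e) x := by
  have hg : (0 : ℝ) < gammaTwo β := by exact_mod_cast gammaTwo_pos β
  by_cases hpd : (hermMatrix β m x).PosDef
  · have hc : ContinuousAt (fun y : HermCoord β m => hermDet y ^ (e / gammaTwo β)) x :=
      (continuous_hermDet β m).continuousAt.rpow_const (Or.inl (hermDet_pos hpd).ne')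
    refine hc.congr ?_
    filter_upwards [(isOpen_posDef β m).mem_nhds hpd] with y hy
    exact (if_pos hy).symm
  by_cases hps : (hermMatrix β m x).PosSemidef
  · have he0 : 0 < e := by tauto
    have hdet : hermDet x = 0 := by
      have := mt hps.posDef_iff_det_ne_zero.2 hpd
      rw [det_hermMatrix] at this
      simpa using this
    have hx : conePow e x = 0 := if_neg hpd
    rw [ContinuousAt, hx]
    have hlim : Filter.Tendsto (fun y : HermCoord β m => |hermDet y| ^ (e / gammaTwo β))
        (nhds x) (nhds 0) := by
      have hc : ContinuousAt (fun y : HermCoord β m => |hermDet y| ^ (e / gammaTwo β)) x :=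
        (continuous_hermDet β m).abs.continuousAt.rpow_const (Or.inr (by positivity))
      have := hc.tendsto
      rwa [hdet, abs_zero, Real.zero_rpow (by positivity)] at this
    refine squeeze_zero (fun y => conePow_nonneg e y) (fun y => ?_) hlim
    unfold conePow
    split_ifs with hy
    · rw [abs_of_pos (hermDet_pos hy)]
    · positivity
  · have hev : (fun _ => 0) =ᶠ[nhds x] conePow e := by
      filter_upwards [(isClosed_posSemidef β m).isOpen_compl.mem_nhds hps] with y hy
      exact (if_neg fun hy' => hy hy'.posSemidef).symm
    exact continuousAt_const.congr hev

theorem continuousAt_coneWeight {β m : ℕ} {a ε : ℝ} (x : HermCoord β m)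
    (h : 0 < a - 1 - β * ((m : ℝ) - 1) / 2 ∨ (hermMatrix β m x).PosDef ∨
      ¬ (hermMatrix β m x).PosSemidef) : ContinuousAt (coneWeight a ε) x :=
  (continuousAt_conePow x h).mul
    (Real.continuous_exp.comp ((continuous_traceForm _).const_mul ε).neg).continuousAt

/-- `coneWeight` in Euclidean coordinates. -/
noncomputable def euclidWeight (β m : ℕ) (a ε : ℝ) (y : EuclideanSpace ℝ (HermIdx β m)) : ℂ :=
  (coneWeight a ε ((hermEuclid β m).symm y) : ℂ)

theorem euclidWeight_hermEuclid {β m : ℕ} (a ε : ℝ) (x : HermCoord β m) :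
    euclidWeight β m a ε (hermEuclid β m x) = coneWeight a ε x := by
  simp [euclidWeight]

theorem continuousAt_euclidWeight {β m : ℕ} {a ε : ℝ} {x : HermCoord β m}
    (h : ContinuousAt (coneWeight a ε) x) :
    ContinuousAt (euclidWeight β m a ε) (hermEuclid β m x) := by
  refine Complex.continuous_ofReal.continuousAt.comp ?_
  refine ContinuousAt.comp (g := coneWeight a ε) ?_ (hermEuclid β m).symm.continuous.continuousAt
  rwa [ContinuousLinearEquiv.symm_apply_apply]

theorem integrable_euclidWeight {β : ℕ} (hβ : β = 1 ∨ β = 2 ∨ β = 4) {m : ℕ} {a ε : ℝ}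
    (ha : ∀ k < m, (β : ℝ) * k / 2 < a) (hε : 0 < ε) : Integrable (euclidWeight β m a ε) := by
  rw [← integrable_comp_hermEuclid]
  simp_rw [euclidWeight_hermEuclid]
  exact (integrable_coneWeight hβ ha hε).ofReal

/-- The Fourier transform of the weight is a product of powers of `ε - i s_j`, where `s_j` are the
eigenvalues of `S`. -/
theorem fourier_euclidWeight {β : ℕ} (hβ : β = 1 ∨ β = 2 ∨ β = 4) {m : ℕ} {a ε : ℝ}
    (ha : ∀ k < m, (β : ℝ) * k / 2 < a) (hε : 0 < ε) (s : HermCoord β m) :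
    hermJacobian β m * 𝓕 (euclidWeight β m a ε) (-hermEuclid β m s) =
      coneGamma β m a * ∏ j, ((ε : ℂ) - Complex.I * (hermMatrix_isHermitian β m s).eigenvalues j) ^
        ((-a / gammaTwo β : ℝ) : ℂ) := by
  rw [← integral_coneWeight_mul_cexp hβ ha hε s, Real.fourier_eq', ← integral_comp_hermEuclid]
  refine integral_congr_ae (ae_of_all _ fun x => ?_)
  beta_reduce
  rw [euclidWeight_hermEuclid, smul_eq_mul, mul_comm, ← inner_hermEuclid hβ, inner_neg_right]
  congr 2
  push_cast
  ring

/-- `det^(-n/γ₁) (S + iε)` is a Fourier transform. -/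
theorem detPow_eq_fourier {β : ℕ} (hβ : β = 1 ∨ β = 2 ∨ β = 4) {m : ℕ} {a ε : ℝ}
    (ha : ∀ k < m, (β : ℝ) * k / 2 < a) (hε : 0 < ε) (s : HermCoord β m) :
    detPow (shiftPlus ε (hermMatrix β m s)) ((-a / gammaTwo β : ℝ) : ℂ) =
      Complex.I ^ ((-(a * m) : ℝ) : ℂ) * (hermJacobian β m / coneGamma β m a : ℝ) *
        𝓕 (euclidWeight β m a ε) (-hermEuclid β m s) := by
  have hK : (coneGamma β m a : ℂ) ≠ 0 := by exact_mod_cast (coneGamma_pos ha).ne'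
  have h := fourier_euclidWeight hβ ha hε s
  rw [detPow_shiftPlus hε, mul_assoc]
  congr 1
  have hdiv : ((hermJacobian β m / coneGamma β m a : ℝ) : ℂ) =
      hermJacobian β m / coneGamma β m a := Complex.ofReal_div _ _
  rw [hdiv, div_mul_eq_mul_div, h, mul_div_cancel_left₀ _ hK]

/-- Squaring the weight doubles its parameters; this decides when it is in `L²`. -/
theorem sq_conePow {β m : ℕ} (e : ℝ) (x : HermCoord β m) : conePow e x ^ 2 = conePow (2 * e) x := by
  unfold conePow
  split_ifs with h
  · rw [← Real.rpow_natCast, ← Real.rpow_mul (hermDet_pos h).le]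
    congr 1
    push_cast; ring
  · simp

theorem memLp_euclidWeight {β : ℕ} (hβ : β = 1 ∨ β = 2 ∨ β = 4) {m : ℕ} {a ε : ℝ}
    (ha : ∀ k < m, (β : ℝ) * k / 2 < a) (hε : 0 < ε)
    (ha2 : ∀ k < m, (β : ℝ) * k / 2 < 2 * a - 1 - β * ((m : ℝ) - 1) / 2) :
    MemLp (euclidWeight β m a ε) 2 := by
  rw [memLp_two_iff_integrable_sq_norm (integrable_euclidWeight hβ ha hε).aestronglyMeasurable]
  have h := integrable_euclidWeight hβ ha2 (ε := 2 * ε) (by positivity)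
  refine h.norm.congr (ae_of_all _ fun y => ?_)
  simp only [euclidWeight, Complex.norm_real, Real.norm_eq_abs,
    abs_of_nonneg (coneWeight_nonneg _ _ _)]
  rw [coneWeight, coneWeight, mul_pow, sq_conePow, ← Real.exp_nat_mul]
  congr 2
  · ring
  · push_cast; ring

/-- In the absolutely convergent range the Fourier transform is integrable: it is a power of
`det (ε - i S)`, hence a multiple of the square of the Fourier transform with `a / 2` in place of
`a`, and the latter is in `L²` by Plancherel. -/
theorem integrable_fourier_euclidWeight {β : ℕ} (hβ : β = 1 ∨ β = 2 ∨ β = 4) {m : ℕ} {a ε : ℝ}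
    (ha : ∀ k < m, (β : ℝ) * k < a) (ha0 : ∀ k < m, (β : ℝ) * k / 2 < a) (hε : 0 < ε)
    (ha2 : ∀ k < m, (β : ℝ) * k / 2 < a - 1 - β * ((m : ℝ) - 1) / 2) :
    Integrable fun y => 𝓕 (euclidWeight β m a ε) (-y) := by
  have hh : ∀ k < m, (β : ℝ) * k / 2 < a / 2 := fun k hk => by linarith [ha k hk]
  have hL : MemLp (𝓕 (euclidWeight β m (a / 2) ε)) 2 :=
    memLp_fourier (integrable_euclidWeight hβ hh hε)
      (memLp_euclidWeight hβ hh hε fun k hk => by linarith [ha2 k hk])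
  have hsq : Integrable fun y => 𝓕 (euclidWeight β m (a / 2) ε) (-y) ^ 2 := by
    have := integrable_comp_neg (MemLp.integrable_mul hL hL)
    refine this.congr (ae_of_all _ fun y => ?_)
    simp [sq]
  have hJ : (hermJacobian β m : ℂ) ≠ 0 := by exact_mod_cast (hermJacobian_pos β m).ne'
  have hK : (coneGamma β m (a / 2) : ℂ) ≠ 0 := by exact_mod_cast (coneGamma_pos hh).ne'
  refine (hsq.const_mul ((hermJacobian β m : ℂ) * coneGamma β m a / coneGamma β m (a / 2) ^ 2)).congr
    (ae_of_all _ fun y => ?_)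
  obtain ⟨s, rfl⟩ := (hermEuclid β m).surjective y
  have h1 := fourier_euclidWeight hβ ha0 hε s
  have h2 := fourier_euclidWeight hβ hh hε s
  have hp : (∏ j, ((ε : ℂ) - Complex.I * (hermMatrix_isHermitian β m s).eigenvalues j) ^
        ((-(a / 2) / gammaTwo β : ℝ) : ℂ)) ^ 2 =
      ∏ j, ((ε : ℂ) - Complex.I * (hermMatrix_isHermitian β m s).eigenvalues j) ^
        ((-a / gammaTwo β : ℝ) : ℂ) := by
    rw [← Finset.prod_pow]
    refine Finset.prod_congr rfl fun j _ => ?_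
    rw [← Complex.cpow_nat_mul]
    congr 1
    push_cast
    ring
  rw [← hp] at h1
  have h3 := congrArg (· ^ 2) h2
  beta_reduce at h3 ⊢
  apply mul_left_cancel₀ hJ
  rw [h1]
  rw [mul_pow, mul_pow] at h3
  generalize (∏ j, ((ε : ℂ) - Complex.I * (hermMatrix_isHermitian β m s).eigenvalues j) ^
    ((-(a / 2) / gammaTwo β : ℝ) : ℂ)) = P at h3 ⊢
  field_simp
  linear_combination (coneGamma β m a : ℂ) * h3

/-! ### The Ingham–Siegel integral -/

theorem trace_hermMatrix {β m : ℕ} (hβ : β = 1 ∨ β = 2 ∨ β = 4) (x : HermCoord β m) :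
    (hermMatrix β m x).trace = (traceForm x (hermOne β m) : ℂ) := by
  rw [← trace_eq_traceForm hβ, hermMatrix_hermOne, Matrix.mul_one]

theorem neg_div_gammaOne {β : ℕ} (n : ℝ) :
    -(n / gammaOne β) = -(β * n / 2) / gammaTwo β := by
  rw [gammaOne, div_div_eq_mul_div, neg_div]
  congr 1
  rw [div_div, mul_comm n]

/-- Up to a constant and the factor `e^(ε tr R)`, the integrand is that of the inverse Fourier
transform of the weight, evaluated at `-S`. -/
theorem inghamIntegrand_eq {β : ℕ} (hβ : β = 1 ∨ β = 2 ∨ β = 4) {m : ℕ} {n ε : ℝ}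
    (ha : ∀ k < m, (β : ℝ) * k / 2 < β * n / 2) (hε : 0 < ε) (r s : HermCoord β m) :
    inghamIntegrand n ε (hermMatrix β m r) (hermMatrix β m s) =
      Complex.I ^ ((-(β * m * n / 2) : ℝ) : ℂ) *
        (hermJacobian β m / coneGamma β m (β * n / 2) : ℝ) *
        Complex.exp (ε * traceForm r (hermOne β m)) *
        (Complex.exp (2 * Real.pi * Complex.I * ⟪hermEuclid β m r, -hermEuclid β m s⟫) *
          𝓕 (euclidWeight β m (β * n / 2) ε) (-hermEuclid β m s)) := by
  rw [inghamIntegrand, neg_div_gammaOne, detPow_eq_fourier hβ ha hε]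
  have h1 : (hermMatrix β m r * shiftPlus ε (hermMatrix β m s)).trace =
      traceForm r s + Complex.I * ε * traceForm r (hermOne β m) := by
    rw [shiftPlus, Matrix.mul_add, Matrix.trace_add, Matrix.mul_smul, Matrix.mul_one,
      Matrix.trace_smul, trace_eq_traceForm hβ, trace_hermMatrix hβ, smul_eq_mul]
  have h2 : Complex.exp (-Complex.I * (traceForm r s + Complex.I * ε * traceForm r (hermOne β m))) =
      Complex.exp (ε * traceForm r (hermOne β m)) *
        Complex.exp (2 * Real.pi * Complex.I * ⟪hermEuclid β m r, -hermEuclid β m s⟫) := by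
    rw [← Complex.exp_add, ← inner_hermEuclid hβ r s, inner_neg_right]
    congr 1
    push_cast
    linear_combination (-(ε : ℂ) * traceForm r (hermOne β m)) * Complex.I_sq
  have h3 : -((β : ℝ) * n / 2 * m) = -(β * m * n / 2) := by ring
  rw [h1, h2, h3]
  ring

theorem inghamExponent_eq {β : ℕ} (hβ : β = 1 ∨ β = 2 ∨ β = 4) (m : ℕ) (n : ℝ) :
    inghamExponent β m n = (β * n / 2 - 1 - β * ((m : ℝ) - 1) / 2) / gammaTwo β := by
  rcases hβ with rfl | rfl | rfl <;> simp only [inghamExponent, gammaOne, gammaTwo] <;>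
    norm_num <;> ring

/-- `V` is `e^(ε tr R)` times the weight, with the constant that `inghamIntegrand_eq` and Fourier
inversion produce. -/
theorem inghamValue_eq {β : ℕ} (hβ : β = 1 ∨ β = 2 ∨ β = 4) {m : ℕ} {n : ℝ} (ε : ℝ)
    (ha : ∀ k < m, (β : ℝ) * k / 2 < β * n / 2) (r : HermCoord β m) :
    inghamValue n (hermMatrix β m r) =
      Complex.I ^ ((-(β * m * n / 2) : ℝ) : ℂ) *
        (hermJacobian β m / coneGamma β m (β * n / 2) : ℝ) *
        Complex.exp (ε * traceForm r (hermOne β m)) *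
        (hermJacobian β m * coneWeight (β * n / 2) ε r) := by
  have h1 : (hermMatrix β m r).det ^ ((inghamExponent β m n : ℝ) : ℂ) *
      matrixHeaviside (hermMatrix β m r) =
        (conePow (β * n / 2 - 1 - β * ((m : ℝ) - 1) / 2) r : ℂ) := by
    rw [matrixHeaviside, conePow]
    split_ifs with h
    · rw [det_hermMatrix, inghamExponent_eq hβ, mul_one, Complex.ofReal_cpow (hermDet_pos h).le]
    · simp
  have h2 : Complex.exp (ε * traceForm r (hermOne β m)) *
      (coneWeight (β * n / 2) ε r : ℂ) =
        (conePow (β * n / 2 - 1 - β * ((m : ℝ) - 1) / 2) r : ℂ) := by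
    rw [coneWeight, Complex.ofReal_mul, Complex.ofReal_exp, mul_left_comm, ← Complex.exp_add]
    push_cast
    rw [add_neg_cancel, Complex.exp_zero, mul_one]
  have h3 : (inghamConstant β m n : ℂ) =
      (hermJacobian β m / coneGamma β m (β * n / 2) : ℝ) * hermJacobian β m := by
    rw [← sq_hermJacobian_div_coneGamma n ha]
    push_cast
    ring
  rw [inghamValue, mul_assoc, h1, ← h2, h3]
  ring

theorem integral_comp_neg_hermEuclid {β m : ℕ} (g : EuclideanSpace ℝ (HermIdx β m) → ℂ) :
    ∫ s, g (-hermEuclid β m s) = hermJacobian β m * ∫ y, g y := by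
  rw [integral_comp_hermEuclid (fun y => g (-y)), integral_comp_neg]

theorem integrable_comp_neg_hermEuclid {β m : ℕ} {g : EuclideanSpace ℝ (HermIdx β m) → ℂ}
    (hg : Integrable g) : Integrable fun s => g (-hermEuclid β m s) :=
  (integrable_comp_hermEuclid (g := fun y => g (-y))).2 (integrable_comp_neg hg)

/-- Gauss regularization in Euclidean coordinates. -/
theorem gaussian_mul_inghamIntegrand_eq {β : ℕ} (hβ : β = 1 ∨ β = 2 ∨ β = 4) {m : ℕ} {n ε : ℝ}
    (ha : ∀ k < m, (β : ℝ) * k / 2 < β * n / 2) (hε : 0 < ε) (δ : ℝ) (r s : HermCoord β m) :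
    Complex.exp (-(δ : ℂ) * (hermMatrix β m s * hermMatrix β m s).trace) *
        inghamIntegrand n ε (hermMatrix β m r) (hermMatrix β m s) =
      Complex.I ^ ((-(β * m * n / 2) : ℝ) : ℂ) *
        (hermJacobian β m / coneGamma β m (β * n / 2) : ℝ) *
        Complex.exp (ε * traceForm r (hermOne β m)) *
        (fun w => Complex.exp (-(2 * Real.pi * δ : ℝ) * ‖w‖ ^ 2 +
          2 * Real.pi * Complex.I * ⟪hermEuclid β m r, w⟫) *
          𝓕 (euclidWeight β m (β * n / 2) ε) w) (-hermEuclid β m s) := by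
  rw [inghamIntegrand_eq hβ ha hε, trace_eq_traceForm hβ, ← inner_hermEuclid hβ,
    real_inner_self_eq_norm_sq]
  beta_reduce
  rw [Complex.exp_add, norm_neg]
  have : -(δ : ℂ) * ((2 * Real.pi * ‖hermEuclid β m s‖ ^ 2 : ℝ) : ℂ) =
      -((2 * Real.pi * δ : ℝ) : ℂ) * (‖hermEuclid β m s‖ : ℂ) ^ 2 := by push_cast; ring
  rw [this]
  ring

/-- The Gauss sum of the Ingham–Siegel integral converges to `V` where the weight is continuous. -/
theorem tendsto_gauss_sum {β : ℕ} (hβ : β = 1 ∨ β = 2 ∨ β = 4) {m : ℕ} {n ε : ℝ}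
    (ha : ∀ k < m, (β : ℝ) * k / 2 < β * n / 2) (hε : 0 < ε) (r : HermCoord β m)
    (hr : ContinuousAt (coneWeight (β * n / 2) ε) r) :
    Filter.Tendsto (fun δ : ℝ => ∫ s : HermCoord β m,
          Complex.exp (-(δ : ℂ) * (hermMatrix β m s * hermMatrix β m s).trace) *
            inghamIntegrand n ε (hermMatrix β m r) (hermMatrix β m s))
        (nhdsWithin 0 (Set.Ioi 0)) (nhds (inghamValue n (hermMatrix β m r))) := by
  have hT := tendsto_integral_gaussian_mul_fourier (integrable_euclidWeight hβ ha hε)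
    (continuousAt_euclidWeight hr)
  have h2 : Filter.Tendsto (fun δ : ℝ => 2 * Real.pi * δ) (nhdsWithin 0 (Set.Ioi 0))
      (nhdsWithin 0 (Set.Ioi 0)) := by
    refine tendsto_nhdsWithin_iff.2 ⟨?_, ?_⟩
    · have hc : Filter.Tendsto (fun δ : ℝ => 2 * Real.pi * δ) (nhds 0) (nhds (2 * Real.pi * 0)) :=
        Filter.tendsto_id.const_mul _
      rw [mul_zero] at hc
      exact hc.mono_left nhdsWithin_le_nhds
    · filter_upwards [self_mem_nhdsWithin] with δ hδ
      have hδ : 0 < δ := hδ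
      exact Set.mem_Ioi.2 (by positivity)
  have h3 := ((hT.comp h2).const_mul (hermJacobian β m : ℂ)).const_mul
    (Complex.I ^ ((-(β * m * n / 2) : ℝ) : ℂ) *
        (hermJacobian β m / coneGamma β m (β * n / 2) : ℝ) *
        Complex.exp (ε * traceForm r (hermOne β m)))
  rw [euclidWeight_hermEuclid, ← inghamValue_eq hβ ε ha] at h3
  refine h3.congr fun δ => ?_
  rw [integral_congr_ae (ae_of_all _ fun s => gaussian_mul_inghamIntegrand_eq hβ ha hε δ r s),
    integral_const_mul]
  congr 1
  exact (integral_comp_neg_hermEuclid _).symm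

theorem integrable_gauss_sum {β : ℕ} (hβ : β = 1 ∨ β = 2 ∨ β = 4) {m : ℕ} {n ε : ℝ}
    (ha : ∀ k < m, (β : ℝ) * k / 2 < β * n / 2) (hε : 0 < ε) (r : HermCoord β m) {δ : ℝ}
    (hδ : 0 < δ) : Integrable (fun s : HermCoord β m =>
        Complex.exp (-(δ : ℂ) * (hermMatrix β m s * hermMatrix β m s).trace) *
          inghamIntegrand n ε (hermMatrix β m r) (hermMatrix β m s)) := by
  simp_rw [gaussian_mul_inghamIntegrand_eq hβ ha hε]
  exact (integrable_comp_neg_hermEuclid (integrable_gaussian_mul_fourier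
    (integrable_euclidWeight hβ ha hε) (by positivity) _)).const_mul _

theorem integrable_inghamIntegrand {β : ℕ} (hβ : β = 1 ∨ β = 2 ∨ β = 4) {m : ℕ} {n ε : ℝ}
    (ha : ∀ k < m, (β : ℝ) * k / 2 < β * n / 2) (ha1 : ∀ k < m, (β : ℝ) * k < β * n / 2)
    (ha2 : ∀ k < m, (β : ℝ) * k / 2 < β * n / 2 - 1 - β * ((m : ℝ) - 1) / 2)
    (hε : 0 < ε) (r : HermCoord β m) : Integrable (fun s : HermCoord β m =>
        inghamIntegrand n ε (hermMatrix β m r) (hermMatrix β m s)) := by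
  simp_rw [inghamIntegrand_eq hβ ha hε]
  refine Integrable.const_mul ?_ _
  have h := integrable_comp_neg (integrable_fourier_euclidWeight hβ ha1 ha hε ha2)
  simp only [neg_neg] at h
  have h' := h.bdd_mul (c := 1)
    (f := fun w => Complex.exp (2 * Real.pi * Complex.I * ⟪hermEuclid β m r, w⟫))
    (Continuous.aestronglyMeasurable (by fun_prop)) (ae_of_all _ fun w => ?_)
  · exact integrable_comp_neg_hermEuclid (g := fun w =>
      Complex.exp (2 * Real.pi * Complex.I * ⟪hermEuclid β m r, w⟫) *
        𝓕 (euclidWeight β m (β * n / 2) ε) w) h'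
  · rw [Complex.norm_exp]
    simp

/-- The absolutely convergent integral is its own Gauss sum. -/
theorem integral_inghamIntegrand {β : ℕ} (hβ : β = 1 ∨ β = 2 ∨ β = 4) {m : ℕ} {n ε : ℝ}
    (ha : ∀ k < m, (β : ℝ) * k / 2 < β * n / 2) (hε : 0 < ε) (r : HermCoord β m)
    (hr : ContinuousAt (coneWeight (β * n / 2) ε) r)
    (hi : Integrable (fun s : HermCoord β m =>
        inghamIntegrand n ε (hermMatrix β m r) (hermMatrix β m s))) :
    ∫ s : HermCoord β m, inghamIntegrand n ε (hermMatrix β m r) (hermMatrix β m s) =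
      inghamValue n (hermMatrix β m r) := by
  -- by dominated convergence
  refine tendsto_nhds_unique ?_ (tendsto_gauss_sum hβ ha hε r hr)
  refine tendsto_integral_filter_of_dominated_convergence
    (fun s => ‖inghamIntegrand n ε (hermMatrix β m r) (hermMatrix β m s)‖) ?_ ?_ hi.norm ?_
  · filter_upwards [self_mem_nhdsWithin] with δ hδ
    exact (integrable_gauss_sum hβ ha hε r hδ).aestronglyMeasurable
  · filter_upwards [self_mem_nhdsWithin] with δ hδ
    have hδ : 0 < δ := hδ
    refine ae_of_all _ fun s => ?_
    rw [norm_mul]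
    refine mul_le_of_le_one_left (norm_nonneg _) ?_
    rw [trace_eq_traceForm hβ, ← inner_hermEuclid hβ, real_inner_self_eq_norm_sq, Complex.norm_exp,
      Real.exp_le_one_iff, ← Complex.ofReal_neg, ← Complex.ofReal_mul, Complex.ofReal_re]
    have := Real.pi_pos
    have : 0 ≤ δ * (2 * Real.pi * ‖hermEuclid β m s‖ ^ 2) := by positivity
    linarith
  · refine ae_of_all _ fun s => ?_
    have hc : Continuous fun δ : ℝ =>
        Complex.exp (-(δ : ℂ) * (hermMatrix β m s * hermMatrix β m s).trace) *
          inghamIntegrand n ε (hermMatrix β m r) (hermMatrix β m s) := by fun_prop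
    simpa using (hc.tendsto 0).mono_left nhdsWithin_le_nhds

/-- The weak form: `e^(ε tr R) φ(R)` is a Schwartz function `ψ`, the inner integral is a multiple of
`𝓕 ψ(S) 𝓕 W(-S)` for the weight `W`, and Parseval's formula applies. -/
theorem integral_test_mul_inghamIntegrand {β : ℕ} (hβ : β = 1 ∨ β = 2 ∨ β = 4) {m : ℕ} {n ε : ℝ}
    (ha : ∀ k < m, (β : ℝ) * k / 2 < β * n / 2) (hε : 0 < ε) (φ : HermCoord β m → ℂ)
    (hφ : IsInghamTest β m ε φ) :
    (∀ s : HermCoord β m, Integrable (fun r : HermCoord β m =>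
        φ r * inghamIntegrand n ε (hermMatrix β m r) (hermMatrix β m s))) ∧
      Integrable (fun s : HermCoord β m => ∫ r : HermCoord β m,
        φ r * inghamIntegrand n ε (hermMatrix β m r) (hermMatrix β m s)) ∧
      Integrable (fun r : HermCoord β m =>
        φ r * inghamValue n (hermMatrix β m r)) ∧
      ∫ s : HermCoord β m, ∫ r : HermCoord β m,
          φ r * inghamIntegrand n ε (hermMatrix β m r) (hermMatrix β m s) =
        ∫ r : HermCoord β m, φ r * inghamValue n (hermMatrix β m r) := by
  obtain ⟨ψ, hψ⟩ := hφ
  set C : ℂ := Complex.I ^ ((-(β * m * n / 2) : ℝ) : ℂ) *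
        (hermJacobian β m / coneGamma β m (β * n / 2) : ℝ) with hC
  obtain ⟨Ψ, hΨ⟩ : ∃ Ψ : 𝓢(EuclideanSpace ℝ (HermIdx β m), ℂ), ∀ x, Ψ (hermEuclid β m x) = ψ x :=
    ⟨SchwartzMap.compCLMOfContinuousLinearEquiv ℂ (hermEuclid β m).symm ψ, fun x => by simp⟩
  have hψ' : ∀ x, φ x * Complex.exp (ε * traceForm x (hermOne β m)) = ψ x := fun x => by
    rw [hψ, trace_hermMatrix hβ, mul_comm]
  set W := euclidWeight β m (β * n / 2) ε with hW
  have hWi : Integrable W := integrable_euclidWeight hβ ha hε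
  have hF : ∀ r s : HermCoord β m,
      φ r * inghamIntegrand n ε (hermMatrix β m r) (hermMatrix β m s) =
        (fun y => Complex.exp ((-2 * Real.pi * ⟪y, hermEuclid β m s⟫ : ℝ) * Complex.I) • Ψ y)
          (hermEuclid β m r) * (C * 𝓕 W (-hermEuclid β m s)) := by
    intro r s
    rw [inghamIntegrand_eq hβ ha hε, ← hC, ← hW]
    beta_reduce
    rw [hΨ, ← hψ', smul_eq_mul, inner_neg_right]
    have : 2 * (Real.pi : ℂ) * Complex.I * ((-⟪hermEuclid β m r, hermEuclid β m s⟫ : ℝ) : ℂ) =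
        ((-2 * Real.pi * ⟪hermEuclid β m r, hermEuclid β m s⟫ : ℝ) : ℂ) * Complex.I := by
      push_cast; ring
    rw [this]
    ring
  have hint : ∀ s : HermCoord β m, Integrable fun y =>
      Complex.exp ((-2 * Real.pi * ⟪y, hermEuclid β m s⟫ : ℝ) * Complex.I) • Ψ y := fun s => by
    refine (Ψ.integrable (μ := volume)).bdd_mul (c := 1)
      (Continuous.aestronglyMeasurable (by fun_prop)) (ae_of_all _ fun y => ?_)
    rw [Complex.norm_exp_ofReal_mul_I]
  have hinner : ∀ s : HermCoord β m, ∫ r : HermCoord β m,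
      φ r * inghamIntegrand n ε (hermMatrix β m r) (hermMatrix β m s) =
        (fun w => hermJacobian β m * C * (𝓕 Ψ w * 𝓕 W (-w))) (hermEuclid β m s) := by
    intro s
    simp_rw [hF]
    rw [integral_mul_const, integral_comp_hermEuclid (fun y =>
      Complex.exp ((-2 * Real.pi * ⟪y, hermEuclid β m s⟫ : ℝ) * Complex.I) • Ψ y),
      ← Real.fourier_eq', SchwartzMap.fourier_coe]
    ring
  have hV : ∀ r : HermCoord β m, φ r * inghamValue n (hermMatrix β m r) =
      (fun y => C * hermJacobian β m * (Ψ y * W y)) (hermEuclid β m r) := by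
    intro r
    rw [inghamValue_eq hβ ε ha, ← hC]
    beta_reduce
    rw [hΨ, ← hψ', hW, euclidWeight_hermEuclid]
    ring
  refine ⟨fun s => ?_, ?_, ?_, ?_⟩
  · simp_rw [hF]
    exact (integrable_comp_hermEuclid.2 (hint s)).mul_const _
  · have h := (integrable_schwartz_mul_fourier_neg hWi (𝓕 Ψ)).const_mul (hermJacobian β m * C)
    exact (integrable_comp_hermEuclid.2 h).congr (ae_of_all _ fun s => (hinner s).symm)
  · have h := (integrable_schwartz_mul hWi Ψ).const_mul (C * hermJacobian β m)
    exact (integrable_comp_hermEuclid.2 h).congr (ae_of_all _ fun r => (hV r).symm)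
  · have hl := integral_comp_hermEuclid fun w => hermJacobian β m * C * (𝓕 Ψ w * 𝓕 W (-w))
    have hr := integral_comp_hermEuclid fun y => C * hermJacobian β m * (Ψ y * W y)
    rw [integral_congr_ae (ae_of_all _ hinner), integral_congr_ae (ae_of_all _ hV)]
    refine hl.trans (Eq.trans ?_ hr.symm)
    rw [integral_const_mul, integral_const_mul, integral_fourier_mul_fourier_neg hWi]
    ring

theorem mainTheorem8 (β : ℕ) (hβ : β = 1 ∨ β = 2 ∨ β = 4) (m : ℕ) (ε : ℝ) (hε : 0 < ε)
    (n : ℝ) (hn : (m : ℝ) - 1 + 2 / (β : ℝ) ≤ n) :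
    -- absolutely convergent range: a Lebesgue integral, for every `R`
    (2 * ((m : ℝ) - 1) + 2 / (β : ℝ) < n → ∀ R ∈ Herm β m,
      MeasureTheory.Integrable
        (fun s : HermCoord β m => inghamIntegrand n ε R (hermMatrix β m s)) ∧
      ∫ s : HermCoord β m, inghamIntegrand n ε R (hermMatrix β m s) = inghamValue n R) ∧
    -- full range, pointwise: a conditionally convergent (Gauss summable) integral
    (∀ R ∈ Herm β m, ((m : ℝ) - 1 + 2 / (β : ℝ) < n ∨ R.PosDef ∨ ¬ R.PosSemidef) →
      (∀ δ : ℝ, 0 < δ → MeasureTheory.Integrable (fun s : HermCoord β m =>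
        Complex.exp (-(δ : ℂ) * (hermMatrix β m s * hermMatrix β m s).trace) *
          inghamIntegrand n ε R (hermMatrix β m s))) ∧
      Filter.Tendsto (fun δ : ℝ => ∫ s : HermCoord β m,
          Complex.exp (-(δ : ℂ) * (hermMatrix β m s * hermMatrix β m s).trace) *
            inghamIntegrand n ε R (hermMatrix β m s))
        (nhdsWithin 0 (Set.Ioi 0)) (nhds (inghamValue n R))) ∧
    -- full range, weakly: first integrate against a test function of `R`, then over `S`
    (∀ φ : HermCoord β m → ℂ, IsInghamTest β m ε φ →
      (∀ s : HermCoord β m, MeasureTheory.Integrable (fun r : HermCoord β m =>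
        φ r * inghamIntegrand n ε (hermMatrix β m r) (hermMatrix β m s))) ∧
      MeasureTheory.Integrable (fun s : HermCoord β m => ∫ r : HermCoord β m,
        φ r * inghamIntegrand n ε (hermMatrix β m r) (hermMatrix β m s)) ∧
      MeasureTheory.Integrable (fun r : HermCoord β m =>
        φ r * inghamValue n (hermMatrix β m r)) ∧
      ∫ s : HermCoord β m, ∫ r : HermCoord β m,
          φ r * inghamIntegrand n ε (hermMatrix β m r) (hermMatrix β m s) =
        ∫ r : HermCoord β m, φ r * inghamValue n (hermMatrix β m r)) := by
  have hβ0 : (0 : ℝ) < β := by rcases hβ with rfl | rfl | rfl <;> norm_num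
  have hk : ∀ k < m, (β : ℝ) * k ≤ β * ((m : ℝ) - 1) := fun k hk => by
    have : (k : ℝ) + 1 ≤ m := by exact_mod_cast hk
    exact mul_le_mul_of_nonneg_left (by linarith) hβ0.le
  -- `n - (m - 1) - 2 / β` is `2 / β` times the exponent of `conePow` in the weight
  have hexp : β * n / 2 - 1 - β * ((m : ℝ) - 1) / 2 = β / 2 * (n - ((m : ℝ) - 1 + 2 / β)) := by
    field_simp
    ring
  have ha : ∀ k < m, (β : ℝ) * k / 2 < β * n / 2 := fun k hkm => by
    have h : 0 ≤ β / 2 * (n - ((m : ℝ) - 1 + 2 / β)) :=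
      mul_nonneg (by positivity) (by linarith)
    linarith [hk k hkm]
  have hcont : ∀ r : HermCoord β m, ((m : ℝ) - 1 + 2 / (β : ℝ) < n ∨ (hermMatrix β m r).PosDef ∨
      ¬ (hermMatrix β m r).PosSemidef) → ContinuousAt (coneWeight (β * n / 2) ε) r :=
    fun r h => continuousAt_coneWeight r <| h.imp_left fun h => by
      rw [hexp]
      exact mul_pos (by positivity) (by linarith)
  refine ⟨fun hn2 R hR => ?_, fun R hR hR' => ?_, fun φ hφ => integral_test_mul_inghamIntegrand hβ ha hε φ hφ⟩
  · rw [← range_hermMatrix β m hβ] at hR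
    obtain ⟨r, rfl⟩ := hR
    have hn2' : β * ((m : ℝ) - 1) + 1 < β * n / 2 := by
      have h : 0 < β / 2 * (n - (2 * ((m : ℝ) - 1) + 2 / β)) :=
        mul_pos (by positivity) (by linarith)
      have h' : β / 2 * (n - (2 * ((m : ℝ) - 1) + 2 / β)) =
          β * n / 2 - (β * ((m : ℝ) - 1) + 1) := by
        field_simp
      linarith
    have hi := integrable_inghamIntegrand hβ ha (fun k hkm => by linarith [hk k hkm])
      (fun k hkm => by linarith [hk k hkm]) hε r
    refine ⟨hi, integral_inghamIntegrand hβ ha hε r (hcont r ?_) hi⟩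
    rcases m.eq_zero_or_pos with rfl | hm
    · -- the empty matrix is positive definite
      exact Or.inr (Or.inl ((hermMatrix_isHermitian β 0 r).posDef_iff_eigenvalues_pos.2
        fun i => i.1.elim0))
    · left
      have : (1 : ℝ) ≤ m := by exact_mod_cast hm
      linarith
  · rw [← range_hermMatrix β m hβ] at hR
    obtain ⟨r, rfl⟩ := hR
    exact ⟨fun δ hδ => integrable_gauss_sum hβ ha hε r hδ,
      tendsto_gauss_sum hβ ha hε r (hcont r hR')⟩
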